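/- **Conventions.** All Banach spaces are complex and $n\ge 1$. *Sequence spaces.* A Banach sequence space is a Banach space $E\subseteq\mathbb C^{\mathbb N}$ with $\ell_1\subseteq E\subseteq\ell_\infty$ such that $y\in E$ and $|x(k)|\le|y(k)|$ for all $k$ imply $x\in E$ and $\|x\|_E\le\|y\|_E$. It is symmetric if for every $x\in E$ the decreasing rearrangement $x^\star(k)=\inf\{\sup_{j\notin J}|x(j)| : J\subseteq\mathbb N,\ \operatorname{card}J<k\}$ lies in $E$ and $\|x^\star\|_E=\|x\|_E$. The Köthe dual of a normed space $X$ of sequences is $X^\times=\{z\in\mathbb C^{\mathbb N}:\sum_j|z(j)x(j)|<\infty \text{ for all } x\in X\}$ with $\|z\|_{X^\times}=\sup_{\|x\|_X\le1}\sum_j|z(j)x(j)|$. *Ideals.* A Banach ideal $\mathfrak A$ of $n$-linear forms assigns to all Banach spaces $E_1,\dots,E_n$ a set $\mathfrak A(E_1,\dots,E_n)$ of continuous $n$-linear forms, closed under sums, with a complete norm, such that (i) every form $\gamma_1\otimes\cdots\otimes\gamma_n:(x_1,\dots,x_n)\mapsto\gamma_1(x_1)\cdots\gamma_n(x_n)$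 with $\gamma_i\in E_i^*$ belongs to $\mathfrak A(E_1,\dots,E_n)$ and has norm $\|\gamma_1\|\cdots\|\gamma_n\|$; (ii) if $T\in\mathfrak A(E_1,\dots,E_n)$ and $S_i:F_i\to E_i$ are bounded operators, then $T\circ(S_1,\dots,S_n)\in\mathfrak A(F_1,\dots,F_n)$ with norm at most $\|T\|_{\mathfrak A}\|S_1\|\cdots\|S_n\|$. We write $\mathfrak A({}^nE)=\mathfrak A(E,\dots,E)$. The ideal $\mathfrak A$ is maximal if, for all $E_1,\dots,E_n$ and all continuous $n$-linear $T$, $T\in\mathfrak A(E_1,\dots,E_n)$ if and only if $\sup\|T|_{M_1\times\cdots\times M_n}\|_{\mathfrak A(M_1,\dots,M_n)}<\infty$, the supremum being over all finite-dimensional subspaces $M_i\subseteq E_i$, and in that case $\|T\|_{\mathfrak A}$ equals this supremum. The tensor norm $\eta$ associated with $\mathfrak A$ is defined for $s\in E_1\otimes\cdots\otimes E_n$ by $\eta(s)=\inf\|s\|_{\mathfrak A(M_1^*,\dots,M_n^*)}$, the infimum being over all finite-dimensional $M_i\subseteq E_i$ with $s\in M_1\otimes\cdots\otimes M_n$, where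 $s$ is regarded as an $n$-linear form on $M_1^*\times\cdots\times M_n^*$. The adjoint ideal is $\mathfrak A^*(E_1,\dots,E_n)=(E_1\otimes_\eta\cdots\otimes_\eta E_n)^*$ with the dual norm, functionals on the tensor product being identified with $n$-linear forms. *Diagonal forms.* For a Banach sequence space $E$, let $\ell_n(\mathfrak A,E)$ be the set of all $\alpha\in\ell_\infty$ for which the diagonal form $T_\alpha(x_1,\dots,x_n)=\sum_k\alpha(k)x_1(k)\cdots x_n(k)$ is well defined on $E\times\cdots\times E$ and belongs to $\mathfrak A({}^nE)$, with the norm $\|\alpha\|_{\ell_n(\mathfrak A,E)}=\|T_\alpha\|_{\mathfrak A({}^nE)}$. **Proposition.** Let $n\ge1$, let $E$ be a symmetric Banach sequence space and $\mathfrak A$ a Banach ideal of $n$-linear forms. Then $$\ell_n(\mathfrak A,E)^\times=\ell_n(\mathfrak A^*,E^\times)$$ as sets of sequences, with equal norms. If moreover $\mathfrak A$ is maximal, then $$\ell_n(\mathfrak A,E)=\ell_n(\mathfrak A^*,E^\times)^\times$$ as sets of sequences, with equal norms. -/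

import Mathlib

open scoped ENNReal BigOperators TensorProduct

noncomputable section

/-! ### Sequence spaces -/

/-- A set of complex sequences together with an (extended) norm. Values of `norm` outside
`carrier` carry no meaning. -/
structure SeqSpace where
  carrier : Set (ℕ → ℂ)
  norm : (ℕ → ℂ) → ℝ≥0∞

/-- Isometric equality of sequence spaces: the same sequences, with the same norms. -/
def SeqSpace.IsometricEq (X Y : SeqSpace) : Prop :=
  X.carrier = Y.carrier ∧ ∀ x ∈ X.carrier, X.norm x = Y.norm x

/-- The Köthe dual, with the norm `‖z‖ = sup_{‖x‖ ≤ 1} ∑ |z(j) x(j)|`. -/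
def SeqSpace.koethe (X : SeqSpace) : SeqSpace where
  carrier := {z | ∀ x ∈ X.carrier, Summable fun j => ‖z j * x j‖}
  norm z := ⨆ x ∈ {x | x ∈ X.carrier ∧ X.norm x ≤ 1}, ∑' j, ‖z j * x j‖ₑ

/-- A Banach sequence space: a complete normed space of complex sequences with
`ℓ₁ ⊆ E ⊆ ℓ_∞` which is solid. The values of `norm` outside `carrier` carry no meaning. -/
structure BanachSeqSpace where
  carrier : Submodule ℂ (ℕ → ℂ)
  norm : (ℕ → ℂ) → ℝ
  norm_add_le : ∀ x ∈ carrier, ∀ y ∈ carrier, norm (x + y) ≤ norm x + norm y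
  norm_smul : ∀ (c : ℂ), ∀ x ∈ carrier, norm (c • x) = ‖c‖ * norm x
  eq_zero_of_norm : ∀ x ∈ carrier, norm x = 0 → x = 0
  complete : ∀ u : ℕ → ℕ → ℂ, (∀ k, u k ∈ carrier) →
    (∀ ε > 0, ∃ K, ∀ j ≥ K, ∀ k ≥ K, norm (u j - u k) < ε) →
    ∃ x ∈ carrier, Filter.Tendsto (fun k => norm (u k - x)) Filter.atTop (nhds 0)
  l1_subset : ∀ x : ℕ → ℂ, (Summable fun k => ‖x k‖) → x ∈ carrier
  subset_linf : ∀ x ∈ carrier, ∃ C : ℝ, ∀ k, ‖x k‖ ≤ C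
  solid : ∀ x : ℕ → ℂ, ∀ y ∈ carrier, (∀ k, ‖x k‖ ≤ ‖y k‖) → x ∈ carrier ∧ norm x ≤ norm y

namespace BanachSeqSpace

variable (E : BanachSeqSpace)

/-- The underlying set and norm. -/
def toSeqSpace : SeqSpace where
  carrier := E.carrier
  norm x := ENNReal.ofReal (E.norm x)

lemma zero_norm : E.norm 0 = 0 := by
  simpa using E.norm_smul 0 0 E.carrier.zero_mem

lemma nonneg_norm {x : ℕ → ℂ} (hx : x ∈ E.carrier) : 0 ≤ E.norm x := by
  have h := E.norm_add_le x hx ((-1 : ℂ) • x) (E.carrier.smul_mem _ hx)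
  rw [E.norm_smul _ x hx] at h
  simp [E.zero_norm] at h
  linarith

/-- The elements of `E` as a type, which carries the norm of `E` (and not the topology of
pointwise convergence). -/
def Space : Type := ↥E.carrier

/-- The sequence underlying an element of `E`. -/
def Space.seq {E : BanachSeqSpace} (x : E.Space) : ℕ → ℂ := (show ↥E.carrier from x).1

instance : AddCommGroup E.Space := inferInstanceAs (AddCommGroup ↥E.carrier)
instance : Module ℂ E.Space := inferInstanceAs (Module ℂ ↥E.carrier)
instance : Norm E.Space := ⟨fun x => E.norm x.seq⟩

lemma core : NormedSpace.Core ℂ E.Space where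
  norm_nonneg x := E.nonneg_norm x.2
  norm_smul c x := E.norm_smul c x.1 x.2
  norm_triangle x y := E.norm_add_le x.1 x.2 y.1 y.2
  norm_eq_zero_iff x := by
    constructor
    · intro h
      exact Subtype.ext (E.eq_zero_of_norm x.1 x.2 h)
    · rintro rfl
      exact E.zero_norm

instance : NormedAddCommGroup E.Space := NormedAddCommGroup.ofCore E.core
instance : NormedSpace ℂ E.Space := NormedSpace.ofCore E.core

instance : CompleteSpace E.Space := by
  apply Metric.complete_of_cauchySeq_tendsto
  intro u hu
  rw [Metric.cauchySeq_iff] at hu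
  obtain ⟨x, hx, h⟩ := E.complete (fun k => (u k).1) (fun k => (u k).2) (by
    intro ε hε
    obtain ⟨K, hK⟩ := hu ε hε
    refine ⟨K, fun j hj k hk => ?_⟩
    have := hK j hj k hk
    rw [dist_eq_norm] at this
    exact this)
  exact ⟨(⟨x, hx⟩ : ↥E.carrier), tendsto_iff_norm_sub_tendsto_zero.2 h⟩

/-- The decreasing rearrangement; `rearr x k` is `x^⋆(k + 1)` when indices start from `1`. -/
def rearr (x : ℕ → ℂ) (k : ℕ) : ℝ :=
  ⨅ J : {J : Finset ℕ // J.card < k + 1}, ⨆ j : {j : ℕ // j ∉ J.1}, ‖x j‖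

/-- `E` is symmetric: `‖x‖ = ‖x^⋆‖` for every `x ∈ E`. -/
def IsSymmetric : Prop :=
  ∀ x ∈ E.carrier, (fun k => (rearr x k : ℂ)) ∈ E.carrier ∧
    E.norm (fun k => (rearr x k : ℂ)) = E.norm x


/-! ### The Köthe dual of a Banach sequence space is a Banach sequence space -/

lemma exists_scaled {x : ℕ → ℂ} (hx : x ∈ E.carrier) :
    ∃ c : ℝ, 0 < c ∧ (c : ℂ) • x ∈ E.carrier ∧ E.norm ((c : ℂ) • x) ≤ 1 := by
  have h0 := E.nonneg_norm hx
  refine ⟨(E.norm x + 1)⁻¹, by positivity, E.carrier.smul_mem _ hx, ?_⟩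
  rw [E.norm_smul _ _ hx, Complex.norm_real, Real.norm_of_nonneg (by positivity),
    inv_mul_le_iff₀ (by positivity)]
  linarith

lemma single_mem (k : ℕ) : (Pi.single k 1 : ℕ → ℂ) ∈ E.carrier := by
  apply E.l1_subset
  apply summable_of_ne_finset_zero (s := {k})
  intro j hj
  simp only [Finset.mem_singleton] at hj
  simp [hj]

lemma tsum_le_koethe_norm (z : ℕ → ℂ) {x : ℕ → ℂ} (hx : x ∈ E.carrier) (h1 : E.norm x ≤ 1) :
    ∑' j, ‖z j * x j‖ₑ ≤ E.toSeqSpace.koethe.norm z :=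
  le_iSup₂ (f := fun x (_ : x ∈ {x | x ∈ E.toSeqSpace.carrier ∧ E.toSeqSpace.norm x ≤ 1}) =>
    ∑' j, ‖z j * x j‖ₑ) x ⟨hx, ENNReal.ofReal_le_one.2 h1⟩

lemma koethe_norm_le {z : ℕ → ℂ} {b : ℝ≥0∞}
    (h : ∀ x ∈ E.carrier, E.norm x ≤ 1 → ∑' j, ‖z j * x j‖ₑ ≤ b) :
    E.toSeqSpace.koethe.norm z ≤ b :=
  iSup₂_le fun x hx => h x hx.1 (ENNReal.ofReal_le_one.1 hx.2)

lemma exists_coord_le (k : ℕ) :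
    ∃ c : ℝ, 0 < c ∧ ∀ z, ‖z k‖ₑ * ENNReal.ofReal c ≤ E.toSeqSpace.koethe.norm z := by
  obtain ⟨c, hc, hm, h1⟩ := E.exists_scaled (E.single_mem k)
  refine ⟨c, hc, fun z => le_trans ?_ (E.tsum_le_koethe_norm z hm h1)⟩
  refine le_trans (le_of_eq ?_) (ENNReal.le_tsum k)
  simp only [Pi.smul_apply, Pi.single_eq_same, smul_eq_mul, mul_one, enorm_mul]
  congr 1
  rw [← ofReal_norm, Complex.norm_real, Real.norm_of_nonneg hc.le]

lemma abs_coord_le (k : ℕ) : ∃ C : ℝ, ∀ x ∈ E.carrier, ‖x k‖ ≤ C * E.norm x := by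
  have he := E.single_mem k
  have hpos : 0 < E.norm (Pi.single k 1) := by
    refine lt_of_le_of_ne (E.nonneg_norm he) fun h => ?_
    have := congrFun (E.eq_zero_of_norm _ he h.symm) k
    simp at this
  refine ⟨(E.norm (Pi.single k 1))⁻¹, fun x hx => ?_⟩
  have h := (E.solid (x k • Pi.single k 1) x hx (by
    intro j
    by_cases hj : j = k
    · subst hj; simp
    · simp [hj])).2
  rw [E.norm_smul _ _ he] at h
  rw [inv_mul_eq_div, le_div_iff₀ hpos]
  exact h

/-- The `k`-th coordinate functional. -/
def coordCLM (k : ℕ) : E.Space →L[ℂ] ℂ :=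
  LinearMap.mkContinuousOfExistsBound
    { toFun := fun x => x.seq k
      map_add' := fun _ _ => rfl
      map_smul' := fun _ _ => rfl }
    ((E.abs_coord_le k).imp fun _ h x => h x.1 x.2)

lemma koethe_norm_ne_top {z : ℕ → ℂ} (hz : z ∈ E.toSeqSpace.koethe.carrier) :
    E.toSeqSpace.koethe.norm z ≠ ⊤ := by
  let φ : ℕ → E.Space →L[ℂ] ℂ := fun N => ∑ j ∈ Finset.range N, z j • E.coordCLM j
  have hφ : ∀ N x, φ N x = ∑ j ∈ Finset.range N, z j * x.seq j := by
    intro N x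
    simp only [φ, sum_apply]
    rfl
  obtain ⟨C, hC⟩ := banach_steinhaus (g := φ) (fun x => ⟨∑' j, ‖z j * x.seq j‖, fun N => by
    rw [hφ]
    exact (norm_sum_le _ _).trans ((hz x.1 x.2).sum_le_tsum _ fun _ _ => norm_nonneg _)⟩)
  refine ne_top_of_le_ne_top (ENNReal.ofReal_ne_top (r := C)) (E.koethe_norm_le fun x hx h1 => ?_)
  refine ENNReal.tsum_le_of_sum_range_le fun N => ?_
  have hu : ∀ w : ℂ, ∃ θ : ℂ, ‖θ‖ ≤ 1 ∧ θ * w = ‖w‖ := by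
    intro w
    by_cases hw : w = 0
    · exact ⟨0, by simp, by simp [hw]⟩
    · have hw' : (‖w‖ : ℂ) ≠ 0 := by simpa using hw
      exact ⟨‖w‖ / w, by simp [hw], by field_simp⟩
  choose θ hθ1 hθ2 using hu
  obtain ⟨hy, hy1⟩ := E.solid (fun j => θ (z j * x j) * x j) x hx (fun j => by
    rw [norm_mul]
    exact mul_le_of_le_one_left (norm_nonneg _) (hθ1 _))
  let y : E.Space := (⟨_, hy⟩ : ↥E.carrier)
  have hyn : ‖y‖ ≤ 1 := hy1.trans h1
  have h2 : φ N y = ((∑ j ∈ Finset.range N, ‖z j * x j‖ : ℝ) : ℂ) := by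
    rw [hφ]
    push_cast
    refine Finset.sum_congr rfl fun j _ => ?_
    rw [← hθ2]
    change z j * (θ (z j * x j) * x j) = _
    ring
  have h3 : ∑ j ∈ Finset.range N, ‖z j * x j‖ ≤ C := by
    have h4 : ‖φ N y‖ ≤ C * 1 :=
      ((φ N).le_opNorm y).trans (mul_le_mul (hC N) hyn (norm_nonneg y)
        ((norm_nonneg _).trans (hC N)))
    rw [h2, Complex.norm_real, mul_one] at h4
    exact (le_abs_self _).trans h4
  calc ∑ j ∈ Finset.range N, ‖z j * x j‖ₑ
      = ENNReal.ofReal (∑ j ∈ Finset.range N, ‖z j * x j‖) := by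
        rw [ENNReal.ofReal_sum_of_nonneg fun _ _ => norm_nonneg _]
        simp only [ofReal_norm]
    _ ≤ ENNReal.ofReal C := ENNReal.ofReal_le_ofReal h3

lemma mem_koethe_of_ne_top {z : ℕ → ℂ} (hz : E.toSeqSpace.koethe.norm z ≠ ⊤) :
    z ∈ E.toSeqSpace.koethe.carrier := by
  intro x hx
  obtain ⟨c, hc, hm, h1⟩ := E.exists_scaled hx
  have h2 : ∑' j, ‖z j * ((c : ℂ) • x) j‖ₑ ≠ ⊤ :=
    ne_top_of_le_ne_top hz (E.tsum_le_koethe_norm z hm h1)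
  have h3 : Summable fun j => ‖z j * ((c : ℂ) • x) j‖ := by
    have := ENNReal.summable_toReal h2
    simpa only [toReal_enorm] using this
  refine (h3.mul_left c⁻¹).congr fun j => ?_
  simp only [Pi.smul_apply, smul_eq_mul, norm_mul, Complex.norm_real, Real.norm_of_nonneg hc.le]
  field_simp

lemma koethe_norm_add_le (z w : ℕ → ℂ) : E.toSeqSpace.koethe.norm (z + w) ≤
    E.toSeqSpace.koethe.norm z + E.toSeqSpace.koethe.norm w := by
  refine E.koethe_norm_le fun x hx h1 => ?_
  refine le_trans ?_ (add_le_add (E.tsum_le_koethe_norm z hx h1) (E.tsum_le_koethe_norm w hx h1))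
  rw [← ENNReal.tsum_add]
  refine ENNReal.tsum_le_tsum fun j => ?_
  rw [Pi.add_apply, add_mul]
  exact enorm_add_le _ _

lemma koethe_norm_smul (c : ℂ) (z : ℕ → ℂ) : E.toSeqSpace.koethe.norm (c • z) =
    ‖c‖ₑ * E.toSeqSpace.koethe.norm z := by
  simp only [SeqSpace.koethe, ENNReal.mul_iSup, ← ENNReal.tsum_mul_left, Pi.smul_apply,
    smul_eq_mul, mul_assoc, enorm_mul]

lemma koethe_norm_mono {z w : ℕ → ℂ} (h : ∀ k, ‖z k‖ ≤ ‖w k‖) :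
    E.toSeqSpace.koethe.norm z ≤ E.toSeqSpace.koethe.norm w := by
  refine E.koethe_norm_le fun x hx h1 => le_trans ?_ (E.tsum_le_koethe_norm w hx h1)
  refine ENNReal.tsum_le_tsum fun j => ?_
  rw [enorm_mul, enorm_mul]
  gcongr
  exact enorm_le_iff_norm_le.2 (h j)

lemma koethe_bounded {z : ℕ → ℂ} (hz : z ∈ E.toSeqSpace.koethe.carrier) :
    ∃ C : ℝ, ∀ k, ‖z k‖ ≤ C := by
  by_contra hcon
  have hfr : ∀ m : ℕ, ∃ᶠ k in Filter.atTop, (2 : ℝ) ^ m ≤ ‖z k‖ := by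
    intro m hm
    apply hcon
    have : Filter.IsBoundedUnder (· ≤ ·) Filter.atTop (fun k => ‖z k‖) :=
      ⟨2 ^ m, by
        rw [Filter.eventually_map]
        filter_upwards [hm] with k hk
        exact (not_le.1 hk).le⟩
    obtain ⟨C, hC⟩ := this.bddAbove_range
    exact ⟨C, fun k => hC ⟨k, rfl⟩⟩
  obtain ⟨φ, hφ, h⟩ := Filter.extraction_forall_of_frequently hfr
  let x : ℕ → ℂ := Function.extend φ (fun m => (1 / 2 : ℂ) ^ m) 0
  have hx0 : ∀ j, j ∉ Set.range φ → x j = 0 := fun j hj => by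
    simp only [x]
    rw [Function.extend_apply' _ _ _ (by simpa using hj)]
    rfl
  have hxφ : ∀ m, x (φ m) = (1 / 2 : ℂ) ^ m := fun m => hφ.injective.extend_apply _ _ _
  have hx : x ∈ E.carrier := by
    apply E.l1_subset
    rw [← hφ.injective.summable_iff (fun j hj => by simp [hx0 j hj])]
    have := summable_geometric_two
    refine this.congr fun m => ?_
    simp [hxφ]
  have h2 := ((hz x hx).comp_injective hφ.injective).tendsto_atTop_zero
  have h3 : ∀ m, 1 ≤ ‖z (φ m) * x (φ m)‖ := by
    intro m
    rw [hxφ, norm_mul]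
    simp only [one_div, inv_pow, norm_inv, norm_pow, Complex.norm_ofNat]
    rw [← div_eq_mul_inv, one_le_div (by positivity)]
    exact h m
  have := ge_of_tendsto' h2 h3
  linarith

/-- The Köthe dual `E^×` of a Banach sequence space, as a Banach sequence space. -/
def koethe : BanachSeqSpace where
  carrier :=
    { carrier := E.toSeqSpace.koethe.carrier
      zero_mem' := fun x _ => by simp
      add_mem' := fun {z w} hz hw => E.mem_koethe_of_ne_top
        (ne_top_of_le_ne_top (ENNReal.add_ne_top.2
          ⟨E.koethe_norm_ne_top hz, E.koethe_norm_ne_top hw⟩) (E.koethe_norm_add_le z w))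
      smul_mem' := fun c z hz => E.mem_koethe_of_ne_top (by
        rw [E.koethe_norm_smul]
        exact ENNReal.mul_ne_top enorm_ne_top (E.koethe_norm_ne_top hz)) }
  norm z := (E.toSeqSpace.koethe.norm z).toReal
  norm_add_le z hz w hw := by
    have h1 := E.koethe_norm_ne_top hz
    have h2 := E.koethe_norm_ne_top hw
    rw [← ENNReal.toReal_add h1 h2]
    exact ENNReal.toReal_mono (ENNReal.add_ne_top.2 ⟨h1, h2⟩) (E.koethe_norm_add_le z w)
  norm_smul c z _ := by
    rw [E.koethe_norm_smul, ENNReal.toReal_mul, toReal_enorm]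
  eq_zero_of_norm z hz h := by
    have h0 : E.toSeqSpace.koethe.norm z = 0 :=
      ((ENNReal.toReal_eq_zero_iff _).1 h).resolve_right (E.koethe_norm_ne_top hz)
    funext k
    obtain ⟨c, hc, hk⟩ := E.exists_coord_le k
    have := hk z
    rw [h0, nonpos_iff_eq_zero, mul_eq_zero] at this
    rcases this with h1 | h1
    · simpa using h1
    · exact absurd (ENNReal.ofReal_eq_zero.1 h1) (not_le.2 hc)
  complete u hu hc := by
    have hsub : ∀ j k, u j - u k ∈ E.toSeqSpace.koethe.carrier := fun j k x hx => by
      refine Summable.of_nonneg_of_le (fun _ => norm_nonneg _) (fun i => ?_)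
        ((hu j x hx).add (hu k x hx))
      rw [Pi.sub_apply, sub_mul]
      exact norm_sub_le _ _
    have hlim : ∀ i, ∃ l, Filter.Tendsto (fun k => u k i) Filter.atTop (nhds l) := by
      intro i
      apply cauchySeq_tendsto_of_complete
      rw [Metric.cauchySeq_iff]
      intro ε hε
      obtain ⟨c, hc0, hi⟩ := E.exists_coord_le i
      obtain ⟨K, hK⟩ := hc (ε * c) (by positivity)
      refine ⟨K, fun j hj k hk => ?_⟩
      have h1 := (ENNReal.toReal_mono (E.koethe_norm_ne_top (hsub j k)) (hi (u j - u k))).trans_lt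
        (hK j hj k hk)
      rw [ENNReal.toReal_mul, toReal_enorm, ENNReal.toReal_ofReal hc0.le] at h1
      rw [dist_eq_norm]
      exact lt_of_mul_lt_mul_right h1 hc0.le
    choose z hz using hlim
    have hb : ∀ ε > 0, ∃ K, ∀ j ≥ K, E.toSeqSpace.koethe.norm (u j - z) ≤ ENNReal.ofReal ε := by
      intro ε hε
      obtain ⟨K, hK⟩ := hc ε hε
      refine ⟨K, fun j hj => E.koethe_norm_le fun x hx h1 =>
        ENNReal.tsum_le_of_sum_range_le fun N => ?_⟩
      have ht : Filter.Tendsto (fun k => ∑ i ∈ Finset.range N, ‖(u j - u k) i * x i‖ₑ)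
          Filter.atTop (nhds (∑ i ∈ Finset.range N, ‖(u j - z) i * x i‖ₑ)) := by
        refine tendsto_finsetSum _ fun i _ => ?_
        exact (((tendsto_const_nhds.sub (hz i)).mul_const (x i))).enorm
      refine le_of_tendsto ht ?_
      filter_upwards [Filter.eventually_ge_atTop K] with k hk
      refine (ENNReal.sum_le_tsum _).trans ((E.tsum_le_koethe_norm _ hx h1).trans ?_)
      rw [ENNReal.le_ofReal_iff_toReal_le (E.koethe_norm_ne_top (hsub j k)) hε.le]
      exact (hK j hj k hk).le
    have hmem : z ∈ E.toSeqSpace.koethe.carrier := by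
      obtain ⟨K, hK⟩ := hb 1 one_pos
      have h1 := E.mem_koethe_of_ne_top (ne_top_of_le_ne_top ENNReal.ofReal_ne_top (hK K le_rfl))
      intro x hx
      refine Summable.of_nonneg_of_le (fun _ => norm_nonneg _) (fun i => ?_)
        ((hu K x hx).add (h1 x hx))
      have : z i * x i = u K i * x i - (u K - z) i * x i := by
        rw [Pi.sub_apply]; ring
      rw [this]
      exact norm_sub_le _ _
    refine ⟨z, hmem, ?_⟩
    rw [Metric.tendsto_atTop]
    intro ε hε
    obtain ⟨K, hK⟩ := hb (ε / 2) (by positivity)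
    refine ⟨K, fun j hj => ?_⟩
    rw [Real.dist_eq, sub_zero, abs_of_nonneg ENNReal.toReal_nonneg]
    have := ENNReal.toReal_mono ENNReal.ofReal_ne_top (hK j hj)
    rw [ENNReal.toReal_ofReal (by positivity)] at this
    linarith
  l1_subset z hz x hx := by
    obtain ⟨C, hC⟩ := E.subset_linf x hx
    refine Summable.of_nonneg_of_le (fun _ => norm_nonneg _) (fun i => ?_) (hz.mul_right C)
    rw [norm_mul]
    exact mul_le_mul_of_nonneg_left (hC i) (norm_nonneg _)
  subset_linf z hz := E.koethe_bounded hz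
  solid z w hw h := by
    have h1 := E.koethe_norm_mono h
    have h2 := E.koethe_norm_ne_top hw
    exact ⟨E.mem_koethe_of_ne_top (ne_top_of_le_ne_top h2 h1), ENNReal.toReal_mono h2 h1⟩

end BanachSeqSpace

/-! ### Ideals of multilinear forms -/

/-- A class of continuous `n`-linear forms on (complex) Banach spaces with a norm on each of its
components. Values of `norm` outside `carrier` carry no meaning. -/
structure FormClass (n : ℕ) where
  carrier : ∀ (E : Fin n → Type) [∀ i, NormedAddCommGroup (E i)] [∀ i, NormedSpace ℂ (E i)]
    [∀ i, CompleteSpace (E i)], Set (ContinuousMultilinearMap ℂ E ℂ)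
  norm : ∀ (E : Fin n → Type) [∀ i, NormedAddCommGroup (E i)] [∀ i, NormedSpace ℂ (E i)]
    [∀ i, CompleteSpace (E i)], ContinuousMultilinearMap ℂ E ℂ → ℝ

section Ideals

variable {n : ℕ}

/-- The `n`-linear form `(x₁, …, xₙ) ↦ γ₁(x₁) ⋯ γₙ(xₙ)`. -/
def rankOneForm {E : Fin n → Type} [∀ i, NormedAddCommGroup (E i)] [∀ i, NormedSpace ℂ (E i)]
    (γ : ∀ i, StrongDual ℂ (E i)) : ContinuousMultilinearMap ℂ E ℂ :=
  (ContinuousMultilinearMap.mkPiAlgebra ℂ (Fin n) ℂ).compContinuousLinearMap γ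

/-- `A` is a Banach ideal of `n`-linear forms: it contains the forms `γ₁ ⋯ γₙ`, is closed under
sums and under composition with operators, its components are complete normed spaces, the norm
of `γ₁ ⋯ γₙ` is `‖γ₁‖ ⋯ ‖γₙ‖`, and `‖T ∘ (S₁, …, Sₙ)‖_A ≤ ‖T‖_A ‖S₁‖ ⋯ ‖Sₙ‖`. -/
structure IsBanachIdeal (A : FormClass n) : Prop where
  rankOne_mem : ∀ (E : Fin n → Type) [∀ i, NormedAddCommGroup (E i)] [∀ i, NormedSpace ℂ (E i)]
    [∀ i, CompleteSpace (E i)] (γ : ∀ i, StrongDual ℂ (E i)), rankOneForm γ ∈ A.carrier E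
  add_mem : ∀ (E : Fin n → Type) [∀ i, NormedAddCommGroup (E i)] [∀ i, NormedSpace ℂ (E i)]
    [∀ i, CompleteSpace (E i)], ∀ S ∈ A.carrier E, ∀ T ∈ A.carrier E, S + T ∈ A.carrier E
  comp_mem : ∀ (E F : Fin n → Type)
    [∀ i, NormedAddCommGroup (E i)] [∀ i, NormedSpace ℂ (E i)] [∀ i, CompleteSpace (E i)]
    [∀ i, NormedAddCommGroup (F i)] [∀ i, NormedSpace ℂ (F i)] [∀ i, CompleteSpace (F i)]
    (S : ∀ i, F i →L[ℂ] E i), ∀ T ∈ A.carrier E, T.compContinuousLinearMap S ∈ A.carrier F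
  norm_add_le : ∀ (E : Fin n → Type) [∀ i, NormedAddCommGroup (E i)] [∀ i, NormedSpace ℂ (E i)]
    [∀ i, CompleteSpace (E i)], ∀ S ∈ A.carrier E, ∀ T ∈ A.carrier E,
      A.norm E (S + T) ≤ A.norm E S + A.norm E T
  norm_smul : ∀ (E : Fin n → Type) [∀ i, NormedAddCommGroup (E i)] [∀ i, NormedSpace ℂ (E i)]
    [∀ i, CompleteSpace (E i)] (c : ℂ), ∀ T ∈ A.carrier E, A.norm E (c • T) = ‖c‖ * A.norm E T
  eq_zero_of_norm : ∀ (E : Fin n → Type) [∀ i, NormedAddCommGroup (E i)]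
    [∀ i, NormedSpace ℂ (E i)] [∀ i, CompleteSpace (E i)], ∀ T ∈ A.carrier E,
      A.norm E T = 0 → T = 0
  norm_rankOne : ∀ (E : Fin n → Type) [∀ i, NormedAddCommGroup (E i)] [∀ i, NormedSpace ℂ (E i)]
    [∀ i, CompleteSpace (E i)] (γ : ∀ i, StrongDual ℂ (E i)),
      A.norm E (rankOneForm γ) = ∏ i, ‖γ i‖
  norm_comp_le : ∀ (E F : Fin n → Type)
    [∀ i, NormedAddCommGroup (E i)] [∀ i, NormedSpace ℂ (E i)] [∀ i, CompleteSpace (E i)]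
    [∀ i, NormedAddCommGroup (F i)] [∀ i, NormedSpace ℂ (F i)] [∀ i, CompleteSpace (F i)]
    (S : ∀ i, F i →L[ℂ] E i), ∀ T ∈ A.carrier E,
      A.norm F (T.compContinuousLinearMap S) ≤ A.norm E T * ∏ i, ‖S i‖
  complete : ∀ (E : Fin n → Type) [∀ i, NormedAddCommGroup (E i)] [∀ i, NormedSpace ℂ (E i)]
    [∀ i, CompleteSpace (E i)] (u : ℕ → ContinuousMultilinearMap ℂ E ℂ),
      (∀ k, u k ∈ A.carrier E) →
      (∀ ε > 0, ∃ K, ∀ j ≥ K, ∀ k ≥ K, A.norm E (u j - u k) < ε) →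
      ∃ T ∈ A.carrier E,
        Filter.Tendsto (fun k => A.norm E (u k - T)) Filter.atTop (nhds 0)

/-- The norms `‖T|_{M₁ × ⋯ × Mₙ}‖_A` of the restrictions of `T` to finite-dimensional
subspaces. -/
def FormClass.restrictionNorms (A : FormClass n) (E : Fin n → Type)
    [∀ i, NormedAddCommGroup (E i)] [∀ i, NormedSpace ℂ (E i)]
    (T : ContinuousMultilinearMap ℂ E ℂ) : Set ℝ :=
  {r | ∃ (M : ∀ i, Submodule ℂ (E i)) (_ : ∀ i, FiniteDimensional ℂ (M i)),
    haveI : ∀ i, CompleteSpace (M i) := fun i => FiniteDimensional.complete ℂ (M i)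
    r = A.norm (fun i => M i) (T.compContinuousLinearMap fun i => (M i).subtypeL)}

/-- The maximal hull `A^max`. -/
def FormClass.maxHull (A : FormClass n) : FormClass n where
  carrier E _ _ _ := {T | BddAbove (A.restrictionNorms E T)}
  norm E _ _ _ T := sSup (A.restrictionNorms E T)

/-- `A` is maximal: `A = A^max` with equal norms. -/
def FormClass.IsMaximal (A : FormClass n) : Prop :=
  ∀ (E : Fin n → Type) [∀ i, NormedAddCommGroup (E i)] [∀ i, NormedSpace ℂ (E i)]
    [∀ i, CompleteSpace (E i)],
    A.carrier E = A.maxHull.carrier E ∧ ∀ T ∈ A.carrier E, A.norm E T = A.maxHull.norm E T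

/-- The value of the tensor `t ∈ M₁ ⊗ ⋯ ⊗ Mₙ`, regarded as an `n`-linear form on
`M₁^* × ⋯ × Mₙ^*`, at `γ`: on elementary tensors,
`(x₁ ⊗ ⋯ ⊗ xₙ)(γ₁, …, γₙ) = γ₁(x₁) ⋯ γₙ(xₙ)`. -/
def tensorEval {M : Fin n → Type} [∀ i, NormedAddCommGroup (M i)] [∀ i, NormedSpace ℂ (M i)]
    (t : ⨂[ℂ] i, M i) (γ : ∀ i, StrongDual ℂ (M i)) : ℂ :=
  PiTensorProduct.lift (rankOneForm γ).toMultilinearMap t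

/-- The finitely generated tensor norm `η` associated with `A`. For finite-dimensional spaces
`Mᵢ` the norm of `t ∈ M₁ ⊗ ⋯ ⊗ Mₙ` is the norm of the `n`-linear form `S` on
`M₁^* × ⋯ × Mₙ^*` that `t` represents, taken in `A(M₁^*, …, Mₙ^*)`; for Banach spaces `Eᵢ`,
`η(s)` is the infimum over all finite-dimensional subspaces `Mᵢ ⊆ Eᵢ` with
`s ∈ M₁ ⊗ ⋯ ⊗ Mₙ`. -/
def FormClass.tensorNorm (A : FormClass n) (E : Fin n → Type)
    [∀ i, NormedAddCommGroup (E i)] [∀ i, NormedSpace ℂ (E i)] (s : ⨂[ℂ] i, E i) : ℝ :=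
  sInf {r | ∃ (M : ∀ i, Submodule ℂ (E i)) (_ : ∀ i, FiniteDimensional ℂ (M i))
    (t : ⨂[ℂ] i, M i) (S : ContinuousMultilinearMap ℂ (fun i => StrongDual ℂ (M i)) ℂ),
    PiTensorProduct.map (fun i => (M i).subtype) t = s ∧ (∀ γ, S γ = tensorEval t γ) ∧
    r = A.norm (fun i => StrongDual ℂ (M i)) S}

/-- The adjoint ideal `A^*`: the components are the duals `(E₁ ⊗_η ⋯ ⊗_η Eₙ)^*` with the dual
norm, where an `n`-linear form is identified with a linear functional on the tensor product. -/
def FormClass.adjoint (A : FormClass n) : FormClass n where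
  carrier E _ _ _ := {T | ∃ C : ℝ, ∀ s : ⨂[ℂ] i, E i,
    ‖PiTensorProduct.lift T.toMultilinearMap s‖ ≤ C * A.tensorNorm E s}
  norm E _ _ _ T := sInf {C : ℝ | 0 ≤ C ∧ ∀ s : ⨂[ℂ] i, E i,
    ‖PiTensorProduct.lift T.toMultilinearMap s‖ ≤ C * A.tensorNorm E s}

/-- `T` is the diagonal form `T_α(x₁, …, xₙ) = ∑ₖ α(k) x₁(k) ⋯ xₙ(k)` on `E`. -/
def IsDiagonalForm (E : BanachSeqSpace) (α : ℕ → ℂ)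
    (T : ContinuousMultilinearMap ℂ (fun _ : Fin n => E.Space) ℂ) : Prop :=
  ∀ x : Fin n → E.Space, HasSum (fun k => α k * ∏ i, (x i).seq k) (T x)

/-- The space `ℓₙ(A, E)` of all bounded sequences `α` such that `T_α` belongs to `A(ⁿE)`, with
the norm `‖α‖ = ‖T_α‖_A`. (The infimum below is over the single form `T_α`.) -/
def diagSpace (A : FormClass n) (E : BanachSeqSpace) : SeqSpace where
  carrier := {α | (∃ C : ℝ, ∀ k, ‖α k‖ ≤ C) ∧
    ∃ T ∈ A.carrier (fun _ : Fin n => E.Space), IsDiagonalForm E α T}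
  norm α := ⨅ T ∈ {T | T ∈ A.carrier (fun _ : Fin n => E.Space) ∧ IsDiagonalForm E α T},
    ENNReal.ofReal (A.norm (fun _ : Fin n => E.Space) T)

end Ideals

end

open scoped ENNReal BigOperators TensorProduct

noncomputable section

/-! Write X for the space of diagonal forms of A over E, and e_k for the unit vectors. The basic
tool is averaging over characters (`exists_isDiagonalForm_truncate`): for every R in A(ⁿE), the
diagonal form with coefficients R(e_k, …, e_k), k < N, has ideal norm at most that of R. With its
help X is itself a Banach sequence space (`diagBanach`), to which Köthe duality applies.

Let z ∈ X^× and let s be a tensor over E^×, represented by a form S on duals of finite-dimensional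
subspaces M_i of E^×. The pairing gives contractions E → M_i^*; composing S with them yields a form
in A(ⁿE) whose diagonal, for k < N, is that of s. Hence |⟨T_z, s⟩| ≤ ‖z‖ ‖S‖
(`sum_norm_mul_tensorDiag_le`), and T_z lies in the adjoint ideal. Conversely, for β finitely
supported in the unit ball of X, the tensor ∑ β_k e_k ⊗ ⋯ ⊗ e_k over E^× has η at most 1
(`tensorNorm_sum_unit_le`), because γ ↦ ∑ γ(e_k) e_k is a contraction into E from the dual of the
span of these unit vectors in E^×. This rests on the fact that pairing with E^× computes the norm of
E on finitely supported sequences (`norm_le_of_pairing`). Testing T_α on such tensors bounds ∑ |α_k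
β_k|.

For the second identity, X ⊆ X^×× always holds contractively. If α ∈ X^××, its truncations are
bounded in X and their diagonal forms converge pointwise to T_α. On finite-dimensional subspaces
pointwise limits preserve ideal-norm bounds (`norm_le_of_tendsto`), so maximality puts T_α in A. The
first identity then rewrites X^××. -/

lemma exists_phase (w : ℂ) : ∃ θ : ℂ, ‖θ‖ ≤ 1 ∧ θ * w = ‖w‖ := by
  by_cases hw : w = 0
  · exact ⟨0, by simp, by simp [hw]⟩
  · have hw' : (‖w‖ : ℂ) ≠ 0 := by simpa using hw
    exact ⟨‖w‖ / w, by simp [hw], by field_simp⟩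

/-- The sequence `x` with all entries from index `N` on replaced by `0`. -/
def truncate (N : ℕ) (x : ℕ → ℂ) : ℕ → ℂ := fun k => if k < N then x k else 0

lemma truncate_of_lt {N k : ℕ} (h : k < N) (x : ℕ → ℂ) : truncate N x k = x k := if_pos h

lemma truncate_of_ge {N k : ℕ} (h : N ≤ k) (x : ℕ → ℂ) : truncate N x k = 0 := if_neg h.not_gt

lemma norm_truncate_le (N : ℕ) (x : ℕ → ℂ) (k : ℕ) : ‖truncate N x k‖ ≤ ‖x k‖ := by
  unfold truncate
  split_ifs <;> simp

/-! ### Köthe duality on finitely supported sequences, and the effect of symmetry. -/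

namespace BanachSeqSpace

variable (E : BanachSeqSpace)

lemma mem_of_forall_ge {N : ℕ} {x : ℕ → ℂ} (h : ∀ k, N ≤ k → x k = 0) : x ∈ E.carrier := by
  apply E.l1_subset
  apply summable_of_ne_finset_zero (s := Finset.range N)
  intro j hj
  simp [h j (by simpa using hj)]

lemma truncate_mem (N : ℕ) (x : ℕ → ℂ) : truncate N x ∈ E.carrier :=
  E.mem_of_forall_ge fun _ hk => truncate_of_ge hk x

variable {E}

/-- An element of the sequence space, as an element of the type `E.Space`. -/
def Space.mk (x : ℕ → ℂ) (hx : x ∈ E.carrier) : E.Space := (⟨x, hx⟩ : ↥E.carrier)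

@[simp] lemma Space.seq_mk (x : ℕ → ℂ) (hx : x ∈ E.carrier) : (Space.mk x hx).seq = x := rfl

lemma Space.seq_mem (x : E.Space) : x.seq ∈ E.carrier := x.2

lemma Space.ext_seq {x y : E.Space} (h : ∀ k, x.seq k = y.seq k) : x = y :=
  Subtype.ext (funext h)

lemma Space.norm_eq (x : E.Space) : ‖x‖ = E.norm x.seq := rfl

@[simp] lemma Space.seq_add (x y : E.Space) (k : ℕ) : (x + y).seq k = x.seq k + y.seq k := rfl

@[simp] lemma Space.seq_smul (c : ℂ) (x : E.Space) (k : ℕ) : (c • x).seq k = c * x.seq k := rfl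

@[simp] lemma coordCLM_apply (k : ℕ) (x : E.Space) : E.coordCLM k x = x.seq k := rfl

@[simp] lemma Space.seq_zero (k : ℕ) : (0 : E.Space).seq k = 0 := rfl

lemma Space.seq_sum {ι : Type*} (s : Finset ι) (f : ι → E.Space) (k : ℕ) :
    (∑ i ∈ s, f i).seq k = ∑ i ∈ s, (f i).seq k := by
  exact map_sum (E.coordCLM k) f s

variable (E)

/-- The `k`-th unit vector. -/
def unit (k : ℕ) : E.Space := Space.mk (Pi.single k 1) (E.single_mem k)

lemma seq_unit (j k : ℕ) : (E.unit j).seq k = if k = j then 1 else 0 := by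
  simp [unit, Pi.single_apply]

@[simp] lemma seq_unit_self (k : ℕ) : (E.unit k).seq k = 1 := by simp [seq_unit]

lemma norm_unit_pos (k : ℕ) : 0 < ‖E.unit k‖ := by
  rw [norm_pos_iff]
  intro h
  have : (E.unit k).seq k = (0 : E.Space).seq k := by rw [h]
  simp at this

lemma norm_seq_mul_le (x : E.Space) (k : ℕ) : ‖x.seq k‖ * ‖E.unit k‖ ≤ ‖x‖ := by
  have h := (E.solid ((x.seq k • E.unit k).seq) x.seq x.2 (by
    intro j
    rw [Space.seq_smul, seq_unit]
    split_ifs with hj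
    · simp [hj]
    · simp)).2
  have h2 := _root_.norm_smul (x.seq k) (E.unit k)
  rw [← h2]
  exact h

/-- Multiplication by a sequence of numbers of absolute value at most `1`. -/
def mulCLM (m : ℕ → ℂ) (hm : ∀ k, ‖m k‖ ≤ 1) : E.Space →L[ℂ] E.Space :=
  have key (x : E.Space) := E.solid (fun k => m k * x.seq k) x.seq x.2 fun k => by
    rw [norm_mul]
    exact mul_le_of_le_one_left (norm_nonneg _) (hm k)
  LinearMap.mkContinuous
    { toFun := fun x => Space.mk (fun k => m k * x.seq k) (key x).1
      map_add' := fun x y => Space.ext_seq fun k => by simp [mul_add]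
      map_smul' := fun c x => Space.ext_seq fun k => by simp [mul_left_comm] } 1 fun x => by
        rw [one_mul]
        exact (key x).2

@[simp] lemma seq_mulCLM (m : ℕ → ℂ) (hm : ∀ k, ‖m k‖ ≤ 1) (x : E.Space) (k : ℕ) :
    (E.mulCLM m hm x).seq k = m k * x.seq k := rfl

lemma norm_mulCLM_le (m : ℕ → ℂ) (hm : ∀ k, ‖m k‖ ≤ 1) : ‖E.mulCLM m hm‖ ≤ 1 :=
  by
  unfold mulCLM
  exact LinearMap.mkContinuous_norm_le _ zero_le_one _

lemma eq_sum_unit {N : ℕ} {x : E.Space} (h : ∀ k, N ≤ k → x.seq k = 0) :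
    x = ∑ k ∈ Finset.range N, x.seq k • E.unit k := by
  refine Space.ext_seq fun j => ?_
  rw [Space.seq_sum]
  simp only [Space.seq_smul, seq_unit, mul_ite, mul_one, mul_zero, Finset.sum_ite_eq,
    Finset.mem_range]
  split_ifs with hj
  · rfl
  · exact h j (not_lt.1 hj)

variable {E}

/-- The pairing between a Banach sequence space and its Köthe dual. -/
lemma sum_norm_mul_le {z x : ℕ → ℂ} (hz : z ∈ E.koethe.carrier) (hx : x ∈ E.carrier)
    (s : Finset ℕ) : ∑ k ∈ s, ‖z k * x k‖ ≤ E.koethe.norm z * E.norm x := by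
  have h0 : E.norm x = 0 ∨ 0 < E.norm x := (E.nonneg_norm hx).eq_or_lt.imp Eq.symm id
  rcases h0 with h0 | h0
  · have := E.eq_zero_of_norm x hx h0
    subst this
    simp [h0]
  · have hn : E.norm ((((E.norm x)⁻¹ : ℝ) : ℂ) • x) ≤ 1 := by
      rw [E.norm_smul _ x hx, Complex.norm_real, norm_inv, Real.norm_of_nonneg h0.le,
        inv_mul_cancel₀ h0.ne']
    have h1 := E.tsum_le_koethe_norm z (E.carrier.smul_mem (((E.norm x)⁻¹ : ℝ) : ℂ) hx) hn
    have h2 := (ENNReal.sum_le_tsum s).trans h1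
    have h3 := ENNReal.toReal_mono (E.koethe_norm_ne_top hz) h2
    rw [ENNReal.toReal_sum fun _ _ => enorm_ne_top] at h3
    have h4 : ∑ k ∈ s, ‖z k * x k‖ * (E.norm x)⁻¹ ≤ E.koethe.norm z := by
      refine le_trans (le_of_eq (Finset.sum_congr rfl fun k _ => ?_)) h3
      simp only [Pi.smul_apply, smul_eq_mul, toReal_enorm, norm_mul, Complex.norm_real, norm_inv,
        Real.norm_of_nonneg h0.le]
      ring
    rwa [← Finset.sum_mul, ← div_eq_mul_inv, div_le_iff₀ h0] at h4

lemma koethe_norm_le_real {z : ℕ → ℂ} {C : ℝ} (hC : 0 ≤ C)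
    (h : ∀ x ∈ E.carrier, E.norm x ≤ 1 → ∀ N, ∑ k ∈ Finset.range N, ‖z k * x k‖ ≤ C) :
    z ∈ E.koethe.carrier ∧ E.koethe.norm z ≤ C := by
  have h1 : E.toSeqSpace.koethe.norm z ≤ ENNReal.ofReal C := by
    refine E.koethe_norm_le fun x hx hx1 => ENNReal.tsum_le_of_sum_range_le fun N => ?_
    calc ∑ j ∈ Finset.range N, ‖z j * x j‖ₑ
        = ENNReal.ofReal (∑ j ∈ Finset.range N, ‖z j * x j‖) := by
          rw [ENNReal.ofReal_sum_of_nonneg fun _ _ => norm_nonneg _]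
          simp only [ofReal_norm]
      _ ≤ ENNReal.ofReal C := ENNReal.ofReal_le_ofReal (h x hx hx1 N)
  exact ⟨E.mem_koethe_of_ne_top (ne_top_of_le_ne_top ENNReal.ofReal_ne_top h1),
    ENNReal.toReal_le_of_le_ofReal hC h1⟩

/-- On finitely supported sequences the norm of `E` is determined by the Köthe dual. -/
lemma norm_le_of_pairing {N : ℕ} {x : ℕ → ℂ} (h : ∀ k, N ≤ k → x k = 0) {c : ℝ}
    (hc : ∀ y ∈ E.koethe.carrier, (∀ k, N ≤ k → y k = 0) → E.koethe.norm y ≤ 1 →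
      ‖∑ k ∈ Finset.range N, y k * x k‖ ≤ c) : E.norm x ≤ c := by
  let X : E.Space := Space.mk x (E.mem_of_forall_ge h)
  -- A norming functional from Hahn–Banach; its values on the unit vectors, cut off at N, will be
  -- the test sequence y.
  obtain ⟨g, hg, hgx⟩ := exists_dual_vector'' ℂ X
  have hX : g X = ∑ k ∈ Finset.range N, g (E.unit k) * x k := by
    conv_lhs => rw [E.eq_sum_unit (x := X) h]
    simp [map_sum, X, mul_comm]
  have hy := koethe_norm_le_real (E := E) (z := truncate N fun k => g (E.unit k)) zero_le_one (by
    intro u hu hu1 K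
    have h1 : ∀ k, ∃ θ : ℂ, ‖θ‖ ≤ 1 ∧ θ * (truncate N (fun k => g (E.unit k)) k * u k) =
      ‖truncate N (fun k => g (E.unit k)) k * u k‖ := fun k => exists_phase _
    choose θ hθ hθ2 using h1
    -- The test vector stops at `min K N`: the partial sum ends at K and the sequence of values of g
    -- vanishes from N on. Solidity keeps its norm below that of u.
    obtain ⟨hm, hm1⟩ := E.solid (truncate (min K N) fun k => θ k * u k) u hu fun k => by
      refine (norm_truncate_le _ _ _).trans ?_
      rw [norm_mul]
      exact mul_le_of_le_one_left (norm_nonneg _) (hθ k)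
    let v : E.Space := Space.mk _ hm
    have hv : g v = ((∑ k ∈ Finset.range K, ‖truncate N (fun k => g (E.unit k)) k * u k‖ : ℝ) :
        ℂ) := by
      rw [E.eq_sum_unit (x := v) (N := K) fun k hk =>
        truncate_of_ge (le_trans (min_le_left K N) hk) fun k => θ k * u k]
      rw [map_sum, Complex.ofReal_sum]
      refine Finset.sum_congr rfl fun k hk => ?_
      rw [← hθ2, map_smul, smul_eq_mul]
      by_cases hkN : k < N
      · rw [truncate_of_lt hkN]
        simp only [v, Space.seq_mk]
        rw [truncate_of_lt (lt_min (Finset.mem_range.1 hk) hkN)]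
        ring
      · rw [truncate_of_ge (not_lt.1 hkN)]
        simp only [v, Space.seq_mk]
        rw [truncate_of_ge ((min_le_right _ _).trans (not_lt.1 hkN))]
        ring
    have h2 : ‖g v‖ ≤ 1 := (g.le_of_opNorm_le hg v).trans (by
      rw [one_mul]; exact hm1.trans hu1)
    rw [hv, Complex.norm_real] at h2
    exact (le_abs_self _).trans h2)
  have h3 := hc _ hy.1 (fun k hk => truncate_of_ge hk _) hy.2
  have h4 : ∑ k ∈ Finset.range N, truncate N (fun k => g (E.unit k)) k * x k = g X := by
    rw [hX]
    exact Finset.sum_congr rfl fun k hk => by rw [truncate_of_lt (Finset.mem_range.1 hk)]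
  rw [h4, hgx, RCLike.norm_ofReal, abs_of_nonneg (norm_nonneg _)] at h3
  exact h3

lemma koethe_koethe_norm_le {x : ℕ → ℂ} (hx : x ∈ E.carrier) :
    x ∈ E.koethe.koethe.carrier ∧ E.koethe.koethe.norm x ≤ E.norm x := by
  refine koethe_norm_le_real (E.nonneg_norm hx) fun z hz hz1 N => ?_
  simp_rw [mul_comm (x _)]
  exact (sum_norm_mul_le hz hx _).trans (mul_le_of_le_one_left (E.nonneg_norm hx) hz1)

/-- E may differ from its Köthe bidual, but finitely supported sequences do not see the difference.
Later this is applied with the space of diagonal forms in place of E. -/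
lemma norm_truncate_le_koethe_koethe {x : ℕ → ℂ} (hx : x ∈ E.koethe.koethe.carrier) (N : ℕ) :
    E.norm (truncate N x) ≤ E.koethe.koethe.norm x := by
  refine norm_le_of_pairing (N := N) (fun k hk => truncate_of_ge hk _) fun y hy _ hy1 => ?_
  calc ‖∑ k ∈ Finset.range N, y k * truncate N x k‖
      ≤ ∑ k ∈ Finset.range N, ‖x k * y k‖ := by
        refine (norm_sum_le _ _).trans (Finset.sum_le_sum fun k _ => ?_)
        rw [norm_mul, norm_mul, mul_comm]
        exact mul_le_mul_of_nonneg_right (norm_truncate_le _ _ _) (norm_nonneg _)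
    _ ≤ E.koethe.koethe.norm x * E.koethe.norm y := sum_norm_mul_le hx hy _
    _ ≤ _ := mul_le_of_le_one_right (E.koethe.koethe.nonneg_norm hx) hy1

variable (E)

/-- The truncated pairing `(x, z) ↦ ∑_{k < N} x(k) z(k)` on `E × E^×`. -/
def pairing (N : ℕ) : E.Space →L[ℂ] StrongDual ℂ E.koethe.Space :=
  ∑ k ∈ Finset.range N, (E.coordCLM k).smulRight (E.koethe.coordCLM k)

lemma pairing_apply (N : ℕ) (x : E.Space) (z : E.koethe.Space) :
    E.pairing N x z = ∑ k ∈ Finset.range N, x.seq k * z.seq k := by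
  simp [pairing, sum_apply]

lemma norm_pairing_apply_le (N : ℕ) (x : E.Space) (z : E.koethe.Space) :
    ‖E.pairing N x z‖ ≤ ‖x‖ * ‖z‖ := by
  rw [pairing_apply]
  refine (norm_sum_le _ _).trans ?_
  simp_rw [mul_comm (x.seq _)]
  rw [mul_comm]
  exact sum_norm_mul_le z.2 x.2 _

lemma pairing_unit {N k : ℕ} (hk : k < N) : E.pairing N (E.unit k) = E.koethe.coordCLM k := by
  ext z
  simp [pairing_apply, seq_unit, hk]

lemma rearr_comp_equiv (σ : ℕ ≃ ℕ) (x : ℕ → ℂ) : rearr (x ∘ σ) = rearr x := by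
  funext k
  unfold rearr
  refine Equiv.iInf_congr
    ((Equiv.finsetCongr σ).subtypeEquiv fun J => by simp) fun J => ?_
  refine (Equiv.iSup_congr (σ.subtypeEquiv fun j => ?_) fun j => ?_).symm
  · simp
  · simp

variable {E}

/-- Unit vectors are permutations of each other and so share their rearrangement. This is the only
consequence of symmetry that the argument needs. -/
lemma IsSymmetric.norm_unit_eq (hE : E.IsSymmetric) (k : ℕ) : ‖E.unit k‖ = ‖E.unit 0‖ := by
  have h : (Pi.single k 1 : ℕ → ℂ) = (Pi.single 0 1 : ℕ → ℂ) ∘ Equiv.swap 0 k := by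
    funext j
    have : Equiv.swap 0 k j = 0 ↔ j = k := by
      rw [Equiv.swap_apply_eq_iff, Equiv.swap_apply_left]
    simp [Pi.single_apply, this]
  rw [Space.norm_eq, Space.norm_eq, ← (hE _ (E.unit k).seq_mem).2,
    ← (hE _ (E.unit 0).seq_mem).2]
  change E.norm (fun j => (rearr (Pi.single k 1) j : ℂ)) =
    E.norm (fun j => (rearr (Pi.single 0 1) j : ℂ))
  rw [h, rearr_comp_equiv]

end BanachSeqSpace

end

/-! ### Tensors as forms on duals; elementary properties of Banach ideals. -/

noncomputable section

variable {n : ℕ}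

@[simp] lemma rankOneForm_apply {E : Fin n → Type} [∀ i, NormedAddCommGroup (E i)]
    [∀ i, NormedSpace ℂ (E i)] (γ : ∀ i, StrongDual ℂ (E i)) (x : ∀ i, E i) :
    rankOneForm γ x = ∏ i, γ i (x i) := by
  simp [rankOneForm]

lemma tensorEval_tprod {M : Fin n → Type} [∀ i, NormedAddCommGroup (M i)]
    [∀ i, NormedSpace ℂ (M i)] (x : ∀ i, M i) (γ : ∀ i, StrongDual ℂ (M i)) :
    tensorEval (PiTensorProduct.tprod ℂ x) γ = ∏ i, γ i (x i) := by
  simp [tensorEval]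

/-- Every tensor represents a continuous multilinear form on the duals. -/
lemma exists_form_eq_tensorEval {M : Fin n → Type} [∀ i, NormedAddCommGroup (M i)]
    [∀ i, NormedSpace ℂ (M i)] (t : ⨂[ℂ] i, M i) :
    ∃ S : ContinuousMultilinearMap ℂ (fun i => StrongDual ℂ (M i)) ℂ,
      ∀ γ, S γ = tensorEval t γ := by
  induction t using PiTensorProduct.induction_on with
  | smul_tprod r x =>
    refine ⟨r • rankOneForm fun i => NormedSpace.inclusionInDoubleDual ℂ (M i) (x i), fun γ => ?_⟩
    have := tensorEval_tprod x γ
    simp only [tensorEval] at this ⊢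
    rw [map_smul, this]
    simp
  | add s t hs ht =>
    obtain ⟨S, hS⟩ := hs
    obtain ⟨T, hT⟩ := ht
    refine ⟨S + T, fun γ => ?_⟩
    have h1 := hS γ
    have h2 := hT γ
    simp only [tensorEval] at h1 h2 ⊢
    rw [map_add, ← h1, ← h2]
    rfl

/-- Every tensor lives on finite-dimensional subspaces. -/
lemma exists_finiteDimensional_map_eq {E : Fin n → Type} [∀ i, NormedAddCommGroup (E i)]
    [∀ i, NormedSpace ℂ (E i)] (s : ⨂[ℂ] i, E i) :
    ∃ (M : ∀ i, Submodule ℂ (E i)) (_ : ∀ i, FiniteDimensional ℂ (M i)) (t : ⨂[ℂ] i, M i),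
      PiTensorProduct.map (fun i => (M i).subtype) t = s := by
  induction s using PiTensorProduct.induction_on with
  | smul_tprod r x =>
    refine ⟨fun i => ℂ ∙ x i, fun i => inferInstance,
      r • PiTensorProduct.tprod ℂ fun i => ⟨x i, Submodule.mem_span_singleton_self _⟩, ?_⟩
    simp
  | add s t hs ht =>
    obtain ⟨M, hM, s', rfl⟩ := hs
    obtain ⟨M', hM', t', rfl⟩ := ht
    refine ⟨fun i => M i ⊔ M' i, fun i => inferInstance,
      PiTensorProduct.map (fun i => Submodule.inclusion le_sup_left) s' +
        PiTensorProduct.map (fun i => Submodule.inclusion le_sup_right) t', ?_⟩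
    rw [map_add, ← LinearMap.comp_apply, ← LinearMap.comp_apply, ← PiTensorProduct.map_comp,
      ← PiTensorProduct.map_comp]
    rfl

namespace IsBanachIdeal

variable {A : FormClass n}

section

variable {E : Fin n → Type} [∀ i, NormedAddCommGroup (E i)] [∀ i, NormedSpace ℂ (E i)]
  [∀ i, CompleteSpace (E i)]

/-- The norm of the ideal dominates the supremum norm. -/
lemma norm_apply_le (hA : IsBanachIdeal A) {T : ContinuousMultilinearMap ℂ E ℂ}
    (hT : T ∈ A.carrier E) (x : ∀ i, E i) : ‖T x‖ ≤ A.norm E T * ∏ i, ‖x i‖ := by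
  -- Composing with λ ↦ λ x_i turns T into T(x) times the product form on ℂ, whose ideal norm is 1.
  have h := hA.norm_comp_le E (fun _ => ℂ)
    (fun i => (ContinuousLinearMap.id ℂ ℂ).smulRight (x i)) T hT
  have h1 : T.compContinuousLinearMap
      (fun i => (ContinuousLinearMap.id ℂ ℂ).smulRight (x i)) =
      T x • rankOneForm (E := fun _ => ℂ) fun _ : Fin n => ContinuousLinearMap.id ℂ ℂ := by
    ext
    simp
  rw [h1, hA.norm_smul _ _ _ (hA.rankOne_mem _ _), hA.norm_rankOne] at h
  simpa [ContinuousLinearMap.norm_smulRight_apply] using h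

lemma norm_neg (hA : IsBanachIdeal A) {T : ContinuousMultilinearMap ℂ E ℂ}
    (hT : T ∈ A.carrier E) : A.norm E (-T) = A.norm E T := by
  have h := hA.norm_smul E (-1) T hT
  rwa [show (-1 : ℂ) • T = -T by ext; simp, _root_.norm_neg, norm_one, one_mul] at h

variable [NeZero n]

/-- A product of zero functionals; n ≥ 1 matters, since an empty product is 1. -/
lemma zero_mem (hA : IsBanachIdeal A) : (0 : ContinuousMultilinearMap ℂ E ℂ) ∈ A.carrier E := by
  have h := hA.rankOne_mem E 0
  convert h
  ext x
  simp [NeZero.ne n]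

/-- Closure under scalars is not an axiom of `IsBanachIdeal`; it follows from the ideal property by
putting c into one variable, which again requires n ≥ 1. -/
lemma smul_mem (hA : IsBanachIdeal A) (c : ℂ) {T : ContinuousMultilinearMap ℂ E ℂ}
    (hT : T ∈ A.carrier E) : c • T ∈ A.carrier E := by
  have h := hA.comp_mem E E
    (fun i => (if i = 0 then c else 1 : ℂ) • ContinuousLinearMap.id ℂ (E i)) T hT
  convert h
  ext x
  have := T.map_smul_univ (fun i => if i = 0 then c else 1) x
  rw [Finset.prod_ite_eq' Finset.univ (0 : Fin n) fun _ => c] at this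
  refine Eq.trans ?_ this.symm
  simp

lemma neg_mem (hA : IsBanachIdeal A) {T : ContinuousMultilinearMap ℂ E ℂ}
    (hT : T ∈ A.carrier E) : -T ∈ A.carrier E := by
  have h := hA.smul_mem (-1) hT
  rwa [show (-1 : ℂ) • T = -T by ext; simp] at h

lemma sub_mem (hA : IsBanachIdeal A) {S T : ContinuousMultilinearMap ℂ E ℂ}
    (hS : S ∈ A.carrier E) (hT : T ∈ A.carrier E) : S - T ∈ A.carrier E := by
  rw [sub_eq_add_neg]
  exact hA.add_mem E S hS _ (hA.neg_mem hT)

lemma norm_zero (hA : IsBanachIdeal A) : A.norm E 0 = 0 := by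
  have h := hA.norm_smul E 0 0 hA.zero_mem
  rwa [show (0 : ℂ) • (0 : ContinuousMultilinearMap ℂ E ℂ) = 0 by ext; simp,
    _root_.norm_zero, zero_mul] at h

lemma norm_nonneg (hA : IsBanachIdeal A) {T : ContinuousMultilinearMap ℂ E ℂ}
    (hT : T ∈ A.carrier E) : 0 ≤ A.norm E T := by
  have h := hA.norm_add_le E T hT (-T) (hA.neg_mem hT)
  rw [add_neg_cancel, hA.norm_zero, hA.norm_neg hT] at h
  linarith

lemma sum_mem (hA : IsBanachIdeal A) {ι : Type*} (s : Finset ι)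
    {T : ι → ContinuousMultilinearMap ℂ E ℂ} (hT : ∀ i, T i ∈ A.carrier E) :
    ∑ i ∈ s, T i ∈ A.carrier E := by
  classical
  induction s using Finset.induction_on with
  | empty => simpa using hA.zero_mem
  | insert a s ha ih =>
    rw [Finset.sum_insert ha]
    exact hA.add_mem E _ (hT a) _ ih

lemma norm_sum_le (hA : IsBanachIdeal A) {ι : Type*} (s : Finset ι)
    {T : ι → ContinuousMultilinearMap ℂ E ℂ} (hT : ∀ i, T i ∈ A.carrier E) :
    A.norm E (∑ i ∈ s, T i) ≤ ∑ i ∈ s, A.norm E (T i) := by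
  classical
  induction s using Finset.induction_on with
  | empty => simp [hA.norm_zero]
  | insert a s ha ih =>
    rw [Finset.sum_insert ha, Finset.sum_insert ha]
    exact (hA.norm_add_le E _ (hT a) _ (hA.sum_mem s hT)).trans (by gcongr)

lemma norm_comp_le_of_le_one (hA : IsBanachIdeal A) {F : Fin n → Type}
    [∀ i, NormedAddCommGroup (F i)] [∀ i, NormedSpace ℂ (F i)] [∀ i, CompleteSpace (F i)]
    {S : ∀ i, F i →L[ℂ] E i} (hS : ∀ i, ‖S i‖ ≤ 1) {T : ContinuousMultilinearMap ℂ E ℂ}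
    (hT : T ∈ A.carrier E) : A.norm F (T.compContinuousLinearMap S) ≤ A.norm E T :=
  (hA.norm_comp_le E F S T hT).trans (mul_le_of_le_one_right (hA.norm_nonneg hT)
    (Finset.prod_le_one (fun _ _ => _root_.norm_nonneg _) fun i _ => hS i))

lemma norm_restrict_le (hA : IsBanachIdeal A) (M : ∀ i, Submodule ℂ (E i))
    [∀ i, CompleteSpace (M i)] {T : ContinuousMultilinearMap ℂ E ℂ} (hT : T ∈ A.carrier E) :
    A.norm (fun i => M i) (T.compContinuousLinearMap fun i => (M i).subtypeL) ≤ A.norm E T :=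
  hA.norm_comp_le_of_le_one (fun i => (M i).norm_subtypeL_le) hT

end

section FiniteDimensional

variable {E : Fin n → Type} [∀ i, NormedAddCommGroup (E i)] [∀ i, NormedSpace ℂ (E i)]
  [∀ i, FiniteDimensional ℂ (E i)]

/-- The products of coordinate functionals on finite-dimensional spaces. -/
def coordForm (r : ∀ i, Fin (Module.finrank ℂ (E i))) : ContinuousMultilinearMap ℂ E ℂ :=
  rankOneForm fun i => ((Module.finBasis ℂ (E i)).coord (r i)).toContinuousLinearMap

lemma eq_sum_coordForm (T : ContinuousMultilinearMap ℂ E ℂ) :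
    T = ∑ r : (∀ i, Fin (Module.finrank ℂ (E i))),
      T (fun i => Module.finBasis ℂ (E i) (r i)) • coordForm r := by
  ext x
  conv_lhs => rw [show x = fun i => ∑ j, (Module.finBasis ℂ (E i)).repr (x i) j •
    Module.finBasis ℂ (E i) j from funext fun i => ((Module.finBasis ℂ (E i)).sum_repr (x i)).symm]
  rw [T.map_sum, sum_apply]
  refine Finset.sum_congr rfl fun r _ => ?_
  rw [T.map_smul_univ fun i => (Module.finBasis ℂ (E i)).repr (x i) (r i)]
  simp [coordForm, mul_comm]

variable [∀ i, CompleteSpace (E i)] [NeZero n]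

/-- All forms on finite-dimensional spaces belong to the ideal. -/
lemma mem_of_finiteDimensional (hA : IsBanachIdeal A) (T : ContinuousMultilinearMap ℂ E ℂ) :
    T ∈ A.carrier E := by
  rw [eq_sum_coordForm T]
  exact hA.sum_mem _ fun r => hA.smul_mem _ (hA.rankOne_mem E _)

/-- On finite-dimensional spaces pointwise limits preserve bounds for the norm of the ideal. -/
lemma norm_le_of_tendsto (hA : IsBanachIdeal A) {u : ℕ → ContinuousMultilinearMap ℂ E ℂ}
    {T : ContinuousMultilinearMap ℂ E ℂ} {C : ℝ}
    (hu : ∀ x, Filter.Tendsto (fun k => u k x) Filter.atTop (nhds (T x)))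
    (hC : ∀ k, A.norm E (u k) ≤ C) : A.norm E T ≤ C := by
  -- The error T − u k is a combination of finitely many fixed coordinate forms, with coefficients
  -- its values at basis vectors; pointwise convergence makes these tend to zero.
  have h1 : ∀ k, A.norm E T ≤ C + ∑ r : (∀ i, Fin (Module.finrank ℂ (E i))),
      ‖T (fun i => Module.finBasis ℂ (E i) (r i)) - u k (fun i => Module.finBasis ℂ (E i) (r i))‖ *
        A.norm E (coordForm r) := by
    intro k
    have h2 := hA.norm_add_le E (u k) (hA.mem_of_finiteDimensional _) (T - u k)
      (hA.mem_of_finiteDimensional _)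
    rw [add_sub_cancel] at h2
    refine h2.trans (add_le_add (hC k) ?_)
    rw [eq_sum_coordForm (T - u k)]
    refine (hA.norm_sum_le _ fun r => hA.smul_mem _ (hA.rankOne_mem E _)).trans
      (Finset.sum_le_sum fun r _ => ?_)
    rw [hA.norm_smul E _ _ (hA.rankOne_mem E _)]
    rfl
  have h2 : Filter.Tendsto (fun k => C + ∑ r : (∀ i, Fin (Module.finrank ℂ (E i))),
      ‖T (fun i => Module.finBasis ℂ (E i) (r i)) - u k (fun i => Module.finBasis ℂ (E i) (r i))‖ *
        A.norm E (coordForm r)) Filter.atTop (nhds (C + ∑ r : (∀ i, Fin (Module.finrank ℂ (E i))),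
      ‖T (fun i => Module.finBasis ℂ (E i) (r i)) - T (fun i => Module.finBasis ℂ (E i) (r i))‖ *
        A.norm E (coordForm r))) :=
    tendsto_const_nhds.add (tendsto_finsetSum _ fun r _ =>
      ((tendsto_const_nhds.sub (hu _)).norm).mul_const _)
  simpa using ge_of_tendsto' h2 h1

end FiniteDimensional

end IsBanachIdeal

end

/-! ### Diagonal forms and the projection onto the diagonal. -/

noncomputable section

variable {n : ℕ} {E : BanachSeqSpace}

lemma addChar_sum {G M ι : Type*} [AddCommMonoid G] [CommMonoid M] (ψ : AddChar G M)
    (s : Finset ι) (f : ι → G) : ψ (∑ i ∈ s, f i) = ∏ i ∈ s, ψ (f i) :=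
  map_prod ψ.toMonoidHom (fun i => Multiplicative.ofAdd (f i)) s

namespace IsDiagonalForm

variable {α β : ℕ → ℂ} {S T : ContinuousMultilinearMap ℂ (fun _ : Fin n => E.Space) ℂ}

lemma unique (hS : IsDiagonalForm E α S) (hT : IsDiagonalForm E α T) : S = T := by
  ext x
  exact (hS x).unique (hT x)

lemma add (hS : IsDiagonalForm E α S) (hT : IsDiagonalForm E β T) :
    IsDiagonalForm E (α + β) (S + T) := fun x => by
  have h := (hS x).add (hT x)
  simp_rw [← add_mul] at h
  exact h

lemma smul (c : ℂ) (hT : IsDiagonalForm E α T) : IsDiagonalForm E (c • α) (c • T) := fun x => by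
  have h := (hT x).mul_left c
  simp_rw [← mul_assoc] at h
  exact h

lemma apply_unit [NeZero n] (hT : IsDiagonalForm E α T) (k : ℕ) :
    T (fun _ => E.unit k) = α k := by
  refine (hT fun _ => E.unit k).unique ?_
  have h := hasSum_ite_eq k (α k)
  convert h using 2 with j
  simp [BanachSeqSpace.seq_unit, NeZero.ne n]
  split_ifs with h
  · rw [h]
  · rfl

variable (E) in
lemma zero : IsDiagonalForm (n := n) E 0 0 := fun x => by simp

lemma hasSum_truncate (α : ℕ → ℂ) (N : ℕ) (x : Fin n → E.Space) :
    HasSum (fun k => truncate N α k * ∏ i, (x i).seq k)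
      (∑ k ∈ Finset.range N, α k * ∏ i, (x i).seq k) := by
  have h : HasSum (fun k => truncate N α k * ∏ i, (x i).seq k) _ :=
    hasSum_sum_of_ne_finset_zero (s := Finset.range N) fun k hk => by
      rw [truncate_of_ge (by simpa using hk), zero_mul]
  convert h using 1
  exact Finset.sum_congr rfl fun k hk => by rw [truncate_of_lt (Finset.mem_range.1 hk)]

lemma truncate_apply {N : ℕ} (hT : IsDiagonalForm E (truncate N α) T) (x : Fin n → E.Space) :
    T x = ∑ k ∈ Finset.range N, α k * ∏ i, (x i).seq k :=
  (hT x).unique (hasSum_truncate α N x)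

lemma of_apply_eq_sum {N : ℕ}
    (hT : ∀ x, T x = ∑ k ∈ Finset.range N, α k * ∏ i, (x i).seq k) :
    IsDiagonalForm E (truncate N α) T := fun x => by
  rw [hT]
  exact hasSum_truncate α N x

end IsDiagonalForm

/-- Diagonal forms exist as soon as the partial sums of the series are uniformly bounded. -/
lemma exists_isDiagonalForm {α : ℕ → ℂ} {C : ℝ} (h : ∀ (x : Fin n → E.Space) (N : ℕ),
    ∑ k ∈ Finset.range N, ‖α k * ∏ i, (x i).seq k‖ ≤ C * ∏ i, ‖x i‖) :
    ∃ T : ContinuousMultilinearMap ℂ (fun _ : Fin n => E.Space) ℂ, IsDiagonalForm E α T := by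
  have hs : ∀ x : Fin n → E.Space, Summable fun k => ‖α k * ∏ i, (x i).seq k‖ := fun x =>
    summable_of_sum_range_le (fun _ => norm_nonneg _) (h x)
  let T : MultilinearMap ℂ (fun _ : Fin n => E.Space) ℂ :=
    { toFun := fun x => ∑' k, α k * ∏ i, (x i).seq k
      map_update_add' := fun {_} x i a b => by
        rw [← (hs _).of_norm.tsum_add (hs _).of_norm]
        refine tsum_congr fun k => ?_
        -- Each summand is a product of coordinates, so its additivity is that of the multiplication
        -- form composed with the coordinate functionals.
        have := (MultilinearMap.mkPiAlgebra ℂ (Fin n) ℂ).compLinearMap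
          (fun _ => (E.coordCLM k : E.Space →ₗ[ℂ] ℂ)) |>.map_update_add x i a b
        simp only [MultilinearMap.compLinearMap_apply, MultilinearMap.mkPiAlgebra_apply,
          ContinuousLinearMap.coe_coe, BanachSeqSpace.coordCLM_apply] at this
        rw [this, mul_add]
      map_update_smul' := fun {_} x i c a => by
        rw [smul_eq_mul, ← tsum_mul_left]
        refine tsum_congr fun k => ?_
        have := (MultilinearMap.mkPiAlgebra ℂ (Fin n) ℂ).compLinearMap
          (fun _ => (E.coordCLM k : E.Space →ₗ[ℂ] ℂ)) |>.map_update_smul x i c a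
        simp only [MultilinearMap.compLinearMap_apply, MultilinearMap.mkPiAlgebra_apply,
          ContinuousLinearMap.coe_coe, BanachSeqSpace.coordCLM_apply, smul_eq_mul] at this
        rw [this, mul_left_comm] }
  refine ⟨T.mkContinuous C fun x => ?_, fun x => (hs x).of_norm.hasSum⟩
  exact (norm_tsum_le_tsum_norm (hs x)).trans
    ((hs x).tsum_le_of_sum_range_le (h x))

namespace IsBanachIdeal

variable [NeZero n] {A : FormClass n}

/-- Multiplication of a diagonal form by a sequence of numbers of absolute value at most `1`. -/
lemma exists_isDiagonalForm_mul (hA : IsBanachIdeal A) {α m : ℕ → ℂ} (hm : ∀ k, ‖m k‖ ≤ 1)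
    {T : ContinuousMultilinearMap ℂ (fun _ : Fin n => E.Space) ℂ}
    (hT : T ∈ A.carrier fun _ => E.Space) (hα : IsDiagonalForm E α T) :
    ∃ S ∈ A.carrier fun _ => E.Space, IsDiagonalForm E (fun k => m k * α k) S ∧
      A.norm (fun _ => E.Space) S ≤ A.norm (fun _ => E.Space) T := by
  -- Only variable 0 is multiplied, so that each m(k) enters the product once.
  let D : ∀ _ : Fin n, E.Space →L[ℂ] E.Space := fun i =>
    E.mulCLM (fun k => if i = 0 then m k else 1) fun k => by split_ifs <;> simp [hm]
  refine ⟨_, hA.comp_mem _ _ D T hT, fun x => ?_,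
    hA.norm_comp_le_of_le_one (fun i => E.norm_mulCLM_le _ _) hT⟩
  have h := hα fun i => D i (x i)
  have hk : ∀ k, m k * α k * ∏ i, (x i).seq k = α k * ∏ i, (D i (x i)).seq k := fun k => by
    simp only [D, BanachSeqSpace.seq_mulCLM, Finset.prod_mul_distrib, Finset.prod_ite_eq',
      Finset.mem_univ, if_true]
    ring
  simp_rw [hk]
  exact h

/-- The correction in variable 0 turns the product into one of characters evaluated at θ_i (r_i −
r_0), and orthogonality kills every r with some r_i ≠ r_0. The modulus N + 1 separates the indices
below N and keeps the group finite when N = 0. -/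
lemma sum_character_prod (N : ℕ) (r : Fin n → Fin N) :
    ∑ θ : Fin n → ZMod (N + 1), ∏ i, (ZMod.stdAddChar (N := N + 1)
      (θ i * ((r i : ℕ) : ZMod (N + 1)) -
        if i = 0 then (∑ j, θ j) * ((r 0 : ℕ) : ZMod (N + 1)) else 0) : ℂ) =
      if ∀ i, r i = r 0 then ((N + 1 : ℕ) : ℂ) ^ n else 0 := by
  have h1 : ∀ θ : Fin n → ZMod (N + 1), ∏ i, (ZMod.stdAddChar (N := N + 1)
      (θ i * ((r i : ℕ) : ZMod (N + 1)) -
        if i = 0 then (∑ j, θ j) * ((r 0 : ℕ) : ZMod (N + 1)) else 0) : ℂ) =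
      ∏ i, ZMod.stdAddChar (θ i * (((r i : ℕ) : ZMod (N + 1)) - ((r 0 : ℕ) : ZMod (N + 1)))) := by
    intro θ
    rw [← addChar_sum, ← addChar_sum]
    congr 1
    simp only [Finset.sum_sub_distrib, mul_sub, Finset.sum_ite_eq', Finset.mem_univ, if_true,
      Finset.sum_mul]
  simp_rw [h1]
  have h2 := Finset.sum_prod_piFinset (ι := Fin n) (Finset.univ : Finset (ZMod (N + 1)))
    fun i a => (ZMod.stdAddChar (a * (((r i : ℕ) : ZMod (N + 1)) - ((r 0 : ℕ) : ZMod (N + 1)))) : ℂ)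
  rw [Fintype.piFinset_univ] at h2
  rw [h2]
  have h3 : ∀ i, ∑ a : ZMod (N + 1),
      (ZMod.stdAddChar (a * (((r i : ℕ) : ZMod (N + 1)) - ((r 0 : ℕ) : ZMod (N + 1)))) : ℂ) =
      if r i = r 0 then ((N + 1 : ℕ) : ℂ) else 0 := by
    intro i
    rw [AddChar.sum_mulShift _ (ZMod.isPrimitive_stdAddChar (N + 1)), ZMod.card]
    have : ((r i : ℕ) : ZMod (N + 1)) - ((r 0 : ℕ) : ZMod (N + 1)) = 0 ↔ r i = r 0 := by
      rw [sub_eq_zero, ZMod.natCast_eq_natCast_iff', Nat.mod_eq_of_lt (by omega),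
        Nat.mod_eq_of_lt (by omega), Fin.ext_iff]
    simp only [this]
    split_ifs <;> simp
  simp_rw [h3]
  split_ifs with h
  · simp [h]
  · push Not at h
    obtain ⟨i, hi⟩ := h
    exact Finset.prod_eq_zero (Finset.mem_univ i) (if_neg hi)

/-- The projection onto the main diagonal does not increase the norm of the ideal. -/
lemma exists_isDiagonalForm_truncate (hA : IsBanachIdeal A)
    {R : ContinuousMultilinearMap ℂ (fun _ : Fin n => E.Space) ℂ}
    (hR : R ∈ A.carrier fun _ => E.Space) (N : ℕ) :
    ∃ T ∈ A.carrier fun _ => E.Space,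
      IsDiagonalForm E (truncate N fun k => R fun _ => E.unit k) T ∧
      A.norm (fun _ => E.Space) T ≤ A.norm (fun _ => E.Space) R := by
  -- Unimodular weights: variable i is twisted by a character with its own frequency θ_i, and
  -- variable 0 also undoes all the twists, so that the total weight on the diagonal is 1. Averaging
  -- over θ leaves just the diagonal.
  let w : (Fin n → ZMod (N + 1)) → Fin n → ℕ → ℂ := fun θ i k =>
    ZMod.stdAddChar (N := N + 1) (θ i * k - if i = 0 then (∑ j, θ j) * k else 0)
  have hw : ∀ θ i k, ‖truncate N (w θ i) k‖ ≤ 1 := fun θ i k =>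
    (norm_truncate_le _ _ _).trans (AddChar.norm_apply _ _).le
  let D : (Fin n → ZMod (N + 1)) → ∀ _ : Fin n, E.Space →L[ℂ] E.Space := fun θ i =>
    E.mulCLM (truncate N (w θ i)) (hw θ i)
  have hD : ∀ θ i x, D θ i x = ∑ k : Fin N, (w θ i k * x.seq k) • E.unit k := by
    intro θ i x
    rw [E.eq_sum_unit (x := D θ i x) (N := N) fun k hk => by
      simp [D, truncate_of_ge hk], Finset.sum_range]
    exact Finset.sum_congr rfl fun k _ => by simp [D, truncate_of_lt k.2]
  have hmem : ∀ θ, R.compContinuousLinearMap (D θ) ∈ A.carrier fun _ => E.Space :=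
    fun θ => hA.comp_mem _ _ _ R hR
  have hnorm : ∀ θ, A.norm (fun _ => E.Space) (R.compContinuousLinearMap (D θ)) ≤
      A.norm (fun _ => E.Space) R := fun θ =>
    hA.norm_comp_le_of_le_one (fun i => E.norm_mulCLM_le _ _) hR
  have hcard : (0 : ℝ) < ((N + 1 : ℕ) : ℝ) ^ n := by positivity
  refine ⟨(((N + 1 : ℕ) : ℂ) ^ n)⁻¹ • ∑ θ, R.compContinuousLinearMap (D θ),
    hA.smul_mem _ (hA.sum_mem _ hmem), IsDiagonalForm.of_apply_eq_sum fun x => ?_, ?_⟩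
  · have h1 : ∀ θ, R.compContinuousLinearMap (D θ) x = ∑ r : Fin n → Fin N,
        (∏ i, w θ i (r i)) * ((∏ i, (x i).seq (r i)) * R fun i => E.unit (r i)) := by
      intro θ
      rw [ContinuousMultilinearMap.compContinuousLinearMap_apply]
      simp_rw [hD]
      rw [R.map_sum]
      refine Finset.sum_congr rfl fun r _ => ?_
      rw [R.map_smul_univ fun i => w θ i (r i) * (x i).seq (r i), Finset.prod_mul_distrib,
        smul_eq_mul, mul_assoc]
    have h2 : ∀ r : Fin n → Fin N, ∑ θ, ∏ i, w θ i (r i) =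
        if ∀ i, r i = r 0 then ((N + 1 : ℕ) : ℂ) ^ n else 0 := by
      intro r
      rw [← sum_character_prod N r]
      refine Finset.sum_congr rfl fun θ _ => Finset.prod_congr rfl fun i _ => ?_
      simp only [w]
      congr 2
      split_ifs with h
      · rw [h]
      · rfl
    rw [smul_apply, sum_apply]
    simp_rw [h1]
    rw [Finset.sum_comm]
    simp_rw [← Finset.sum_mul, h2, ite_mul, zero_mul]
    rw [← Finset.sum_filter, ← Finset.mul_sum, smul_eq_mul, ← mul_assoc, inv_mul_cancel₀
      (by exact_mod_cast hcard.ne'), one_mul, Finset.sum_range]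
    -- The surviving multi-indices are constant, hence determined by their value at 0.
    refine Finset.sum_bij' (fun r _ => r 0) (fun j _ _ => j) ?_ ?_ ?_ ?_ ?_
    · simp
    · simp
    · intro r hr
      funext i
      exact ((Finset.mem_filter.1 hr).2 i).symm
    · simp
    · intro r hr
      have h : ∀ i, r i = r 0 := (Finset.mem_filter.1 hr).2
      simp only [h]
      ring
  · rw [hA.norm_smul _ _ _ (hA.sum_mem _ hmem), norm_inv, norm_pow, Complex.norm_natCast,
      inv_mul_le_iff₀ hcard]
    refine (hA.norm_sum_le _ hmem).trans ((Finset.sum_le_sum fun θ _ => hnorm θ).trans ?_)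
    simp [ZMod.card]

end IsBanachIdeal

end

/-! ### The diagonal forms of an ideal as a Banach sequence space. -/

noncomputable section

variable {n : ℕ} {E : BanachSeqSpace} {A : FormClass n}

/-- The norm of `T_α` in the ideal. -/
def diagNorm (A : FormClass n) (E : BanachSeqSpace) (α : ℕ → ℂ) : ℝ :=
  sInf {r | ∃ T ∈ A.carrier fun _ => E.Space, IsDiagonalForm E α T ∧
    r = A.norm (fun _ => E.Space) T}

lemma diagNorm_eq {α : ℕ → ℂ} {T : ContinuousMultilinearMap ℂ (fun _ : Fin n => E.Space) ℂ}
    (hT : T ∈ A.carrier fun _ => E.Space) (hd : IsDiagonalForm E α T) :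
    diagNorm A E α = A.norm (fun _ => E.Space) T := by
  have : {r | ∃ T ∈ A.carrier fun _ => E.Space, IsDiagonalForm E α T ∧
      r = A.norm (fun _ => E.Space) T} = {A.norm (fun _ => E.Space) T} := by
    ext r
    constructor
    · rintro ⟨S, _, hSd, rfl⟩
      rw [hSd.unique hd]
      rfl
    · rintro rfl
      exact ⟨T, hT, hd, rfl⟩
  rw [diagNorm, this, csInf_singleton]

lemma diagSpace_norm_eq {α : ℕ → ℂ}
    {T : ContinuousMultilinearMap ℂ (fun _ : Fin n => E.Space) ℂ}
    (hT : T ∈ A.carrier fun _ => E.Space) (hd : IsDiagonalForm E α T) :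
    (diagSpace A E).norm α = ENNReal.ofReal (A.norm (fun _ => E.Space) T) := by
  refine le_antisymm (iInf₂_le T ⟨hT, hd⟩) (le_iInf₂ fun S hS => ?_)
  rw [hS.2.unique hd]

variable [NeZero n]

namespace IsBanachIdeal

/-- The diagonal of a form in the ideal is absolutely summable against products. -/
lemma sum_norm_diagonal_le (hA : IsBanachIdeal A)
    {R : ContinuousMultilinearMap ℂ (fun _ : Fin n => E.Space) ℂ}
    (hR : R ∈ A.carrier fun _ => E.Space) (x : Fin n → E.Space) (N : ℕ) :
    ∑ k ∈ Finset.range N, ‖(R fun _ => E.unit k) * ∏ i, (x i).seq k‖ ≤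
      A.norm (fun _ => E.Space) R * ∏ i, ‖x i‖ := by
  have h : ∀ k, ∃ θ : ℂ, ‖θ‖ ≤ 1 ∧ θ * ((R fun _ => E.unit k) * ∏ i, (x i).seq k) =
    ‖(R fun _ => E.unit k) * ∏ i, (x i).seq k‖ := fun k => exists_phase _
  choose θ hθ hθ2 using h
  obtain ⟨T, hT, hTd, hTn⟩ := hA.exists_isDiagonalForm_truncate hR N
  -- Rotating the coefficients by phases makes the value at x equal to the sum of absolute values,
  -- without increasing the ideal norm.
  obtain ⟨S, hS, hSd, hSn⟩ := hA.exists_isDiagonalForm_mul hθ hT hTd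
  have h1 : (fun k => θ k * truncate N (fun k => R fun _ => E.unit k) k) =
      truncate N fun k => θ k * R fun _ => E.unit k := by
    funext k
    unfold truncate
    split_ifs <;> simp
  rw [h1] at hSd
  have h2 := hA.norm_apply_le hS x
  rw [hSd.truncate_apply] at h2
  simp_rw [mul_assoc, hθ2] at h2
  rw [← Complex.ofReal_sum, Complex.norm_real] at h2
  exact (le_abs_self _).trans (h2.trans (mul_le_mul_of_nonneg_right (hSn.trans hTn)
    (Finset.prod_nonneg fun _ _ => _root_.norm_nonneg _)))

/-- Limits of diagonal forms in the norm of the ideal are diagonal. -/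
lemma isDiagonalForm_of_tendsto (hA : IsBanachIdeal A) {u : ℕ → ℕ → ℂ}
    {S : ℕ → ContinuousMultilinearMap ℂ (fun _ : Fin n => E.Space) ℂ}
    {T : ContinuousMultilinearMap ℂ (fun _ : Fin n => E.Space) ℂ}
    (hS : ∀ k, S k ∈ A.carrier fun _ => E.Space) (hSd : ∀ k, IsDiagonalForm E (u k) (S k))
    (hT : T ∈ A.carrier fun _ => E.Space)
    (h : Filter.Tendsto (fun k => A.norm (fun _ => E.Space) (S k - T)) Filter.atTop (nhds 0)) :
    IsDiagonalForm E (fun k => T fun _ => E.unit k) T := by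
  -- T' is the diagonal form with the diagonal coefficients of T. Both T and T' are pointwise limits
  -- of S k: the coefficients of S k − T' are the diagonal of S k − T, so the previous estimate
  -- applies. Hence T = T'.
  obtain ⟨T', hT'⟩ := exists_isDiagonalForm (fun x N => hA.sum_norm_diagonal_le hT x N)
  have hbound : ∀ x : Fin n → E.Space, Filter.Tendsto
      (fun k => A.norm (fun _ => E.Space) (S k - T) * ∏ i, ‖x i‖) Filter.atTop (nhds 0) :=
    fun x => by simpa using h.mul_const (∏ i, ‖x i‖)
  have h1 : ∀ x, Filter.Tendsto (fun k => S k x - T x) Filter.atTop (nhds 0) := fun x =>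
    squeeze_zero_norm (fun k => hA.norm_apply_le (hA.sub_mem (hS k) hT) x) (hbound x)
  have h2 : ∀ x, Filter.Tendsto (fun k => S k x - T' x) Filter.atTop (nhds 0) := fun x => by
    refine squeeze_zero_norm (fun k => ?_) (hbound x)
    have h3 := (hSd k x).sub (hT' x)
    refine le_of_tendsto h3.tendsto_sum_nat.norm (Filter.Eventually.of_forall fun N => ?_)
    refine (_root_.norm_sum_le _ _).trans (le_trans (le_of_eq (Finset.sum_congr rfl fun j _ => ?_))
      (hA.sum_norm_diagonal_le (hA.sub_mem (hS k) hT) x N))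
    rw [← sub_mul, ← (hSd k).apply_unit j]
    rfl
  have h3 : T = T' := by
    ext x
    have := tendsto_nhds_unique (h1 x) (by simpa using (h2 x).add_const (T' x - T x))
    exact (sub_eq_zero.1 this.symm).symm
  rwa [← h3] at hT'

end IsBanachIdeal

lemma exists_bound_of_diagonal (hE : E.IsSymmetric) (hA : IsBanachIdeal A) {α : ℕ → ℂ}
    {T : ContinuousMultilinearMap ℂ (fun _ : Fin n => E.Space) ℂ}
    (hT : T ∈ A.carrier fun _ => E.Space) (hd : IsDiagonalForm E α T) :
    ∃ C : ℝ, ∀ k, ‖α k‖ ≤ C := by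
  refine ⟨A.norm (fun _ => E.Space) T * ‖E.unit 0‖ ^ n, fun k => ?_⟩
  have h := hA.norm_apply_le hT fun _ => E.unit k
  rw [hd.apply_unit] at h
  simpa [hE.norm_unit_eq k] using h

/-- The series of rank-one forms built from the coordinate functionals converges absolutely in the
ideal norm, because by symmetry all these functionals are bounded by `‖E.unit 0‖⁻¹`. -/
lemma exists_diagonal_of_summable (hE : E.IsSymmetric) (hA : IsBanachIdeal A) {α : ℕ → ℂ}
    (hα : Summable fun k => ‖α k‖) :
    ∃ T ∈ A.carrier fun _ => E.Space, IsDiagonalForm E α T := by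
  let F : ℕ → ContinuousMultilinearMap ℂ (fun _ : Fin n => E.Space) ℂ := fun k =>
    α k • rankOneForm fun _ => E.coordCLM k
  let S : ℕ → ContinuousMultilinearMap ℂ (fun _ : Fin n => E.Space) ℂ := fun N =>
    ∑ k ∈ Finset.range N, F k
  have hF : ∀ k, F k ∈ A.carrier fun _ => E.Space := fun k =>
    hA.smul_mem _ (hA.rankOne_mem _ _)
  have hS : ∀ N, S N ∈ A.carrier fun _ => E.Space := fun N => hA.sum_mem _ hF
  have hSd : ∀ N, IsDiagonalForm E (truncate N α) (S N) := fun N =>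
    IsDiagonalForm.of_apply_eq_sum fun x => by simp [S, F, sum_apply]
  have hcoord : ∀ k, ‖E.coordCLM k‖ ≤ ‖E.unit 0‖⁻¹ := fun k => by
    refine ContinuousLinearMap.opNorm_le_bound _ (by positivity) fun x => ?_
    rw [inv_mul_eq_div, le_div_iff₀ (E.norm_unit_pos 0), ← hE.norm_unit_eq k]
    exact E.norm_seq_mul_le x k
  have hFn : ∀ k, A.norm (fun _ => E.Space) (F k) ≤ ‖α k‖ * (‖E.unit 0‖⁻¹) ^ n := fun k => by
    rw [hA.norm_smul _ _ _ (hA.rankOne_mem _ _), hA.norm_rankOne]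
    gcongr
    simp only [Finset.prod_const, Finset.card_univ, Fintype.card_fin]
    gcongr
    exact hcoord k
  have hsum : Summable fun k => ‖α k‖ * (‖E.unit 0‖⁻¹) ^ n := hα.mul_right _
  have hdiff : ∀ j k, j ≤ k → A.norm (fun _ => E.Space) (S k - S j) ≤
      ∑ i ∈ Finset.range k, ‖α i‖ * (‖E.unit 0‖⁻¹) ^ n -
        ∑ i ∈ Finset.range j, ‖α i‖ * (‖E.unit 0‖⁻¹) ^ n := by
    intro j k hjk
    simp only [S]
    rw [← Finset.sum_Ico_eq_sub _ hjk, ← Finset.sum_Ico_eq_sub _ hjk]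
    exact (hA.norm_sum_le _ hF).trans (Finset.sum_le_sum fun i _ => hFn i)
  obtain ⟨T, hT, hlim⟩ := hA.complete (fun _ => E.Space) S hS (by
    intro ε hε
    obtain ⟨K, hK⟩ := Metric.cauchySeq_iff.1 hsum.hasSum.tendsto_sum_nat.cauchySeq ε hε
    have hle : ∀ j ≥ K, ∀ k ≥ K, j ≤ k → A.norm (fun _ => E.Space) (S k - S j) < ε := by
      intro j hj k hk hjk
      have := hK k hk j hj
      rw [Real.dist_eq] at this
      exact (hdiff j k hjk).trans_lt ((le_abs_self _).trans_lt this)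
    refine ⟨K, fun j hj k hk => ?_⟩
    rcases le_total j k with h | h
    · rw [← neg_sub, hA.norm_neg (hA.sub_mem (hS k) (hS j))]
      exact hle j hj k hk h
    · exact hle k hk j hj h)
  have hd := hA.isDiagonalForm_of_tendsto hS hSd hT hlim
  -- The ideal norm dominates evaluation, so the limit has the coefficients of the partial sums.
  have hcoef : (fun k => T fun _ => E.unit k) = α := by
    funext k
    have h1 : Filter.Tendsto (fun N => (S N - T) fun _ => E.unit k) Filter.atTop (nhds 0) :=
      squeeze_zero_norm (fun N => hA.norm_apply_le (hA.sub_mem (hS N) hT) _)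
        (by simpa using hlim.mul_const (∏ _i : Fin n, ‖E.unit k‖))
    have h2 : Filter.Tendsto (fun N => (S N - T) fun _ => E.unit k) Filter.atTop
        (nhds (α k - T fun _ => E.unit k)) := by
      refine tendsto_const_nhds.congr' ?_
      filter_upwards [Filter.eventually_gt_atTop k] with N hN
      have h3 := (hSd N).apply_unit k
      rw [truncate_of_lt hN] at h3
      rw [← h3]
      rfl
    exact (sub_eq_zero.1 (tendsto_nhds_unique h2 h1)).symm
  exact ⟨T, hT, hcoef ▸ hd⟩

/-- The space of diagonal forms in a Banach ideal over a symmetric Banach sequence space, as a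
Banach sequence space. -/
def diagBanach (hE : E.IsSymmetric) (hA : IsBanachIdeal A) : BanachSeqSpace where
  carrier :=
    { carrier := {α | ∃ T ∈ A.carrier fun _ => E.Space, IsDiagonalForm E α T}
      zero_mem' := ⟨0, hA.zero_mem, IsDiagonalForm.zero E⟩
      add_mem' := by
        rintro α β ⟨S, hS, hSd⟩ ⟨T, hT, hTd⟩
        exact ⟨S + T, hA.add_mem _ S hS T hT, hSd.add hTd⟩
      smul_mem' := by
        rintro c α ⟨T, hT, hTd⟩
        exact ⟨c • T, hA.smul_mem c hT, hTd.smul c⟩ }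
  norm := diagNorm A E
  norm_add_le := by
    rintro α ⟨S, hS, hSd⟩ β ⟨T, hT, hTd⟩
    rw [diagNorm_eq hS hSd, diagNorm_eq hT hTd,
      diagNorm_eq (hA.add_mem _ S hS T hT) (hSd.add hTd)]
    exact hA.norm_add_le _ S hS T hT
  norm_smul := by
    rintro c α ⟨T, hT, hTd⟩
    rw [diagNorm_eq hT hTd, diagNorm_eq (hA.smul_mem c hT) (hTd.smul c)]
    exact hA.norm_smul _ c T hT
  eq_zero_of_norm := by
    rintro α ⟨T, hT, hTd⟩ h
    rw [diagNorm_eq hT hTd] at h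
    funext k
    rw [← hTd.apply_unit k, hA.eq_zero_of_norm _ T hT h]
    rfl
  complete := by
    intro u hu hc
    choose S hS hSd using hu
    have hsub : ∀ j k, IsDiagonalForm E (u j - u k) (S j - S k) := fun j k x => by
      have := (hSd j x).sub (hSd k x)
      simp_rw [← sub_mul] at this
      exact this
    have hnorm : ∀ j k, diagNorm A E (u j - u k) = A.norm (fun _ => E.Space) (S j - S k) :=
      fun j k => diagNorm_eq (hA.sub_mem (hS j) (hS k)) (hsub j k)
    simp_rw [hnorm] at hc
    obtain ⟨T, hT, hlim⟩ := hA.complete _ S hS hc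
    have hd := hA.isDiagonalForm_of_tendsto hS hSd hT hlim
    refine ⟨_, ⟨T, hT, hd⟩, hlim.congr fun k => (diagNorm_eq (hA.sub_mem (hS k) hT) ?_).symm⟩
    intro x
    have := (hSd k x).sub (hd x)
    simp_rw [← sub_mul] at this
    exact this
  l1_subset := fun α hα => exists_diagonal_of_summable hE hA hα
  subset_linf := by
    rintro α ⟨T, hT, hTd⟩
    exact exists_bound_of_diagonal hE hA hT hTd
  solid := by
    rintro α β ⟨T, hT, hTd⟩ h
    -- Where β vanishes the quotient is 0 by convention; this is harmless, as α vanishes there too.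
    obtain ⟨S, hS, hSd, hSn⟩ := hA.exists_isDiagonalForm_mul (m := fun k => α k / β k)
      (fun k => by rw [norm_div]; exact div_le_one_of_le₀ (h k) (norm_nonneg _)) hT hTd
    have hαβ : (fun k => α k / β k * β k) = α := by
      funext k
      by_cases hk : β k = 0
      · have := h k
        rw [hk, norm_zero, norm_le_zero_iff] at this
        simp [hk, this]
      · field_simp
    rw [hαβ] at hSd
    refine ⟨⟨S, hS, hSd⟩, ?_⟩
    rw [diagNorm_eq hS hSd, diagNorm_eq hT hTd]
    exact hSn

lemma mem_diagBanach {hE : E.IsSymmetric} {hA : IsBanachIdeal A} {α : ℕ → ℂ} :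
    α ∈ (diagBanach hE hA).carrier ↔ ∃ T ∈ A.carrier fun _ => E.Space, IsDiagonalForm E α T :=
  Iff.rfl

lemma diagBanach_norm_eq {hE : E.IsSymmetric} {hA : IsBanachIdeal A} {α : ℕ → ℂ}
    {T : ContinuousMultilinearMap ℂ (fun _ : Fin n => E.Space) ℂ}
    (hT : T ∈ A.carrier fun _ => E.Space) (hd : IsDiagonalForm E α T) :
    (diagBanach hE hA).norm α = A.norm (fun _ => E.Space) T :=
  diagNorm_eq hT hd

/-- The boundedness condition in `diagSpace` is automatic over a symmetric space. -/
lemma diagSpace_isometricEq (hE : E.IsSymmetric) (hA : IsBanachIdeal A) :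
    (diagSpace A E).IsometricEq (diagBanach hE hA).toSeqSpace := by
  refine ⟨Set.ext fun α => ⟨fun h => h.2, fun h => ?_⟩, ?_⟩
  · obtain ⟨T, hT, hd⟩ := h
    exact ⟨exists_bound_of_diagonal hE hA hT hd, T, hT, hd⟩
  · rintro α ⟨_, T, hT, hd⟩
    rw [diagSpace_norm_eq hT hd]
    exact congrArg ENNReal.ofReal (diagNorm_eq hT hd).symm

/-- The Köthe dual sees norms only on the carrier, so values elsewhere are irrelevant and the duals
agree as structures. -/
lemma SeqSpace.IsometricEq.koethe_eq {X Y : SeqSpace} (h : X.IsometricEq Y) :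
    X.koethe = Y.koethe := by
  obtain ⟨hc, hn⟩ := h
  have h1 : {x | x ∈ X.carrier ∧ X.norm x ≤ 1} = {x | x ∈ Y.carrier ∧ Y.norm x ≤ 1} := by
    ext x
    constructor
    · rintro ⟨hx, hx1⟩
      exact ⟨hc ▸ hx, hn x hx ▸ hx1⟩
    · rintro ⟨hx, hx1⟩
      have hx' : x ∈ X.carrier := hc ▸ hx
      exact ⟨hx', (hn x hx').symm ▸ hx1⟩
  unfold SeqSpace.koethe
  rw [h1, hc]

lemma BanachSeqSpace.koethe_toSeqSpace (X : BanachSeqSpace) :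
    X.koethe.toSeqSpace.IsometricEq X.toSeqSpace.koethe :=
  ⟨rfl, fun _ hz => ENNReal.ofReal_toReal (X.koethe_norm_ne_top hz)⟩

end

/-! ### The tensor norm over the Köthe dual. -/

noncomputable section

lemma finiteDimensional_strongDual (V : Type*) [NormedAddCommGroup V] [NormedSpace ℂ V]
    [FiniteDimensional ℂ V] : FiniteDimensional ℂ (StrongDual ℂ V) :=
  FiniteDimensional.of_injective (ContinuousLinearMap.coeLM ℂ : StrongDual ℂ V →ₗ[ℂ] V →ₗ[ℂ] ℂ)
    ContinuousLinearMap.coe_injective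

/-- The finite rank operator `γ ↦ ∑_{k < N} γ(e(k)) f(k)`. -/
def dualToSum {V W : Type*} [NormedAddCommGroup V] [NormedSpace ℂ V] [NormedAddCommGroup W]
    [NormedSpace ℂ W] (N : ℕ) (e : ℕ → V) (f : ℕ → W) : StrongDual ℂ V →L[ℂ] W :=
  ∑ k ∈ Finset.range N, (NormedSpace.inclusionInDoubleDual ℂ V (e k)).smulRight (f k)

lemma dualToSum_apply {V W : Type*} [NormedAddCommGroup V] [NormedSpace ℂ V]
    [NormedAddCommGroup W] [NormedSpace ℂ W] (N : ℕ) (e : ℕ → V) (f : ℕ → W)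
    (γ : StrongDual ℂ V) : dualToSum N e f γ = ∑ k ∈ Finset.range N, γ (e k) • f k := by
  simp [dualToSum, sum_apply]

lemma seq_dualToSum_unit {V : Type*} [NormedAddCommGroup V] [NormedSpace ℂ V]
    {E : BanachSeqSpace} {N : ℕ} (e : ℕ → V) (γ : StrongDual ℂ V) (k : ℕ) :
    (dualToSum N e E.unit γ).seq k = truncate N (fun k => γ (e k)) k := by
  rw [dualToSum_apply, BanachSeqSpace.Space.seq_sum]
  simp [BanachSeqSpace.seq_unit, truncate]

/-- By `norm_le_of_pairing` it suffices to pair the image of γ with y in the unit ball of E^×,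
supported below N. The result is γ(∑ y_k e_k), and the isometry ι shows that this vector has norm at
most 1. -/
lemma norm_dualToSum_unit_le {E : BanachSeqSpace} {U : Type*} [NormedAddCommGroup U] [NormedSpace ℂ U] {N : ℕ}
    {e : ℕ → U} (ι : U →ₗᵢ[ℂ] E.koethe.Space) (he : ∀ k < N, ι (e k) = E.koethe.unit k) :
    ‖dualToSum N e E.unit‖ ≤ 1 := by
  refine ContinuousLinearMap.opNorm_le_bound _ zero_le_one fun γ => ?_
  rw [one_mul]
  refine BanachSeqSpace.norm_le_of_pairing (N := N)
    (fun k hk => (seq_dualToSum_unit e γ k).trans (truncate_of_ge hk _)) fun y hy hyN hy1 => ?_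
  have hv : ι (∑ k ∈ Finset.range N, y k • e k) = BanachSeqSpace.Space.mk y hy := by
    rw [E.koethe.eq_sum_unit (x := BanachSeqSpace.Space.mk y hy) hyN, map_sum]
    refine Finset.sum_congr rfl fun k hk => ?_
    rw [map_smul, he k (Finset.mem_range.1 hk)]
    rfl
  have hvn : ‖∑ k ∈ Finset.range N, y k • e k‖ ≤ 1 := by
    rw [← ι.norm_map, hv]
    exact hy1
  have hγv : ∑ k ∈ Finset.range N, y k * (dualToSum N e E.unit γ).seq k =
      γ (∑ k ∈ Finset.range N, y k • e k) := by
    rw [map_sum]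
    refine Finset.sum_congr rfl fun k hk => ?_
    rw [seq_dualToSum_unit, truncate_of_lt (Finset.mem_range.1 hk), map_smul, smul_eq_mul]
  rw [hγv]
  exact (γ.le_opNorm _).trans (mul_le_of_le_one_right (_root_.norm_nonneg _) hvn)

variable {n : ℕ} {E : BanachSeqSpace} {A : FormClass n}

namespace IsBanachIdeal

/-- The value at a tensor of the form `(x₁, …, xₙ) ↦ x₁(k) ⋯ xₙ(k)`. -/
def tensorDiag (F : BanachSeqSpace) (k : ℕ) : (⨂[ℂ] _ : Fin n, F.Space) →ₗ[ℂ] ℂ :=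
  PiTensorProduct.lift (rankOneForm fun _ : Fin n => F.coordCLM k).toMultilinearMap

lemma hasSum_tensorDiag {F : BanachSeqSpace} {α : ℕ → ℂ}
    {T : ContinuousMultilinearMap ℂ (fun _ : Fin n => F.Space) ℂ} (hT : IsDiagonalForm F α T)
    (s : ⨂[ℂ] _ : Fin n, F.Space) :
    HasSum (fun k => α k * tensorDiag F k s) (PiTensorProduct.lift T.toMultilinearMap s) := by
  induction s using PiTensorProduct.induction_on with
  | smul_tprod r x =>
    have h := (hT x).mul_left r
    simp only [tensorDiag, map_smul, PiTensorProduct.lift.tprod, smul_eq_mul,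
      ContinuousMultilinearMap.coe_coe, rankOneForm_apply, BanachSeqSpace.coordCLM_apply]
    simp_rw [mul_left_comm _ r]
    exact h
  | add s t hs ht =>
    simp_rw [map_add, mul_add]
    exact hs.add ht

section TensorNorm

variable {F : Fin n → Type} [∀ i, NormedAddCommGroup (F i)] [∀ i, NormedSpace ℂ (F i)]

/-- The set under the infimum is nonempty because every tensor lives on finite-dimensional
subspaces; otherwise the infimum would be the default value 0. -/
lemma le_tensorNorm {s : ⨂[ℂ] i, F i} {b : ℝ}
    (h : ∀ (M : ∀ i, Submodule ℂ (F i)) (_ : ∀ i, FiniteDimensional ℂ (M i)) (t : ⨂[ℂ] i, M i)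
      (S : ContinuousMultilinearMap ℂ (fun i => StrongDual ℂ (M i)) ℂ),
      PiTensorProduct.map (fun i => (M i).subtype) t = s → (∀ γ, S γ = tensorEval t γ) →
      b ≤ A.norm (fun i => StrongDual ℂ (M i)) S) : b ≤ A.tensorNorm F s := by
  refine le_csInf ?_ ?_
  · obtain ⟨M, hM, t, ht⟩ := exists_finiteDimensional_map_eq s
    obtain ⟨S, hS⟩ := exists_form_eq_tensorEval t
    exact ⟨_, M, hM, t, S, ht, hS, rfl⟩
  · rintro _ ⟨M, hM, t, S, ht, hS, rfl⟩
    exact h M hM t S ht hS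

end TensorNorm

variable [NeZero n]

section TensorNormIdeal

variable {F : Fin n → Type} [∀ i, NormedAddCommGroup (F i)] [∀ i, NormedSpace ℂ (F i)]

lemma norm_nonneg_of_strongDual (hA : IsBanachIdeal A) {M : Fin n → Type}
    [∀ i, NormedAddCommGroup (M i)] [∀ i, NormedSpace ℂ (M i)] [∀ i, FiniteDimensional ℂ (M i)]
    (S : ContinuousMultilinearMap ℂ (fun i => StrongDual ℂ (M i)) ℂ) :
    S ∈ A.carrier (fun i => StrongDual ℂ (M i)) ∧
      0 ≤ A.norm (fun i => StrongDual ℂ (M i)) S := by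
  have : ∀ i, FiniteDimensional ℂ (StrongDual ℂ (M i)) := fun i =>
    finiteDimensional_strongDual (M i)
  have h := hA.mem_of_finiteDimensional S
  exact ⟨h, hA.norm_nonneg h⟩

lemma tensorNorm_nonneg (hA : IsBanachIdeal A) (s : ⨂[ℂ] i, F i) : 0 ≤ A.tensorNorm F s := by
  refine Real.sInf_nonneg ?_
  rintro _ ⟨M, _, t, S, -, -, rfl⟩
  exact (hA.norm_nonneg_of_strongDual S).2

lemma tensorNorm_le (hA : IsBanachIdeal A) {s : ⨂[ℂ] i, F i} (M : ∀ i, Submodule ℂ (F i))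
    [∀ i, FiniteDimensional ℂ (M i)] (t : ⨂[ℂ] i, M i)
    (S : ContinuousMultilinearMap ℂ (fun i => StrongDual ℂ (M i)) ℂ)
    (hs : PiTensorProduct.map (fun i => (M i).subtype) t = s) (hS : ∀ γ, S γ = tensorEval t γ) :
    A.tensorNorm F s ≤ A.norm (fun i => StrongDual ℂ (M i)) S := by
  refine csInf_le ⟨0, ?_⟩ ⟨M, inferInstance, t, S, hs, hS, rfl⟩
  rintro _ ⟨M, _, t, S, -, -, rfl⟩
  exact (hA.norm_nonneg_of_strongDual S).2

end TensorNormIdeal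

/-- A sequence in the Köthe dual of the diagonal space is summable against diagonals of forms in
the ideal. -/
lemma sum_norm_mul_diagonal_le (hE : E.IsSymmetric) (hA : IsBanachIdeal A) {z : ℕ → ℂ}
    (hz : z ∈ (diagBanach hE hA).koethe.carrier)
    {R : ContinuousMultilinearMap ℂ (fun _ : Fin n => E.Space) ℂ}
    (hR : R ∈ A.carrier fun _ => E.Space) (N : ℕ) :
    ∑ k ∈ Finset.range N, ‖z k * R fun _ => E.unit k‖ ≤
      (diagBanach hE hA).koethe.norm z * A.norm (fun _ => E.Space) R := by
  obtain ⟨T, hT, hTd, hTn⟩ := hA.exists_isDiagonalForm_truncate hR N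
  have h := BanachSeqSpace.sum_norm_mul_le hz (mem_diagBanach.2 ⟨T, hT, hTd⟩) (Finset.range N)
  rw [diagBanach_norm_eq hT hTd] at h
  refine le_trans (le_of_eq (Finset.sum_congr rfl fun k hk => ?_)) (h.trans
    (mul_le_mul_of_nonneg_left hTn ((diagBanach hE hA).koethe.nonneg_norm hz)))
  rw [truncate_of_lt (Finset.mem_range.1 hk)]

/-- Pairing with the images under ι gives contractions from E to the duals of the U_i. They pull S
back to a form in A(ⁿE) whose diagonal below N is that of the image tensor, so
`sum_norm_mul_diagonal_le` applies. -/
lemma sum_norm_mul_tensorDiag_map_le (hE : E.IsSymmetric) (hA : IsBanachIdeal A) {z : ℕ → ℂ}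
    (hz : z ∈ (diagBanach hE hA).koethe.carrier) {U : Fin n → Type}
    [∀ i, NormedAddCommGroup (U i)] [∀ i, NormedSpace ℂ (U i)]
    {ι : ∀ i, U i →L[ℂ] E.koethe.Space} (hι : ∀ i, ‖ι i‖ ≤ 1) (t : ⨂[ℂ] i, U i)
    {S : ContinuousMultilinearMap ℂ (fun i => StrongDual ℂ (U i)) ℂ}
    (hS : S ∈ A.carrier fun i => StrongDual ℂ (U i)) (hSt : ∀ γ, S γ = tensorEval t γ) (N : ℕ) :
    ∑ k ∈ Finset.range N, ‖z k * tensorDiag E.koethe k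
      (PiTensorProduct.map (fun i => (ι i : U i →ₗ[ℂ] E.koethe.Space)) t)‖ ≤
      (diagBanach hE hA).koethe.norm z * A.norm (fun i => StrongDual ℂ (U i)) S := by
  let J : ∀ i, E.Space →L[ℂ] StrongDual ℂ (U i) := fun i =>
    ((ContinuousLinearMap.compL ℂ (U i) E.koethe.Space ℂ).flip (ι i)).comp (E.pairing N)
  have hJ : ∀ i, ‖J i‖ ≤ 1 := fun i => by
    refine ContinuousLinearMap.opNorm_le_bound _ zero_le_one fun x => ?_
    refine ContinuousLinearMap.opNorm_le_bound _ (by positivity) fun y => ?_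
    rw [one_mul]
    exact (E.norm_pairing_apply_le N x (ι i y)).trans (mul_le_mul_of_nonneg_left
      (((ι i).le_of_opNorm_le (hι i) y).trans (one_mul _).le) (_root_.norm_nonneg _))
  have hR := hA.comp_mem _ _ J S hS
  refine le_trans (le_of_eq (Finset.sum_congr rfl fun k hk => ?_))
    ((sum_norm_mul_diagonal_le hE hA hz hR N).trans (mul_le_mul_of_nonneg_left
      (hA.norm_comp_le_of_le_one hJ hS) ((diagBanach hE hA).koethe.nonneg_norm hz)))
  have hJk : ∀ i, J i (E.unit k) = (E.koethe.coordCLM k).comp (ι i) := fun i => by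
    rw [← E.pairing_unit (Finset.mem_range.1 hk)]
    rfl
  rw [ContinuousMultilinearMap.compContinuousLinearMap_apply, hSt]
  simp_rw [hJk]
  rw [tensorDiag, ← LinearMap.comp_apply, PiTensorProduct.lift_comp_map]
  rfl

lemma sum_norm_mul_tensorDiag_le (hE : E.IsSymmetric) (hA : IsBanachIdeal A) {z : ℕ → ℂ}
    (hz : z ∈ (diagBanach hE hA).koethe.carrier) (s : ⨂[ℂ] _ : Fin n, E.koethe.Space) (N : ℕ) :
    ∑ k ∈ Finset.range N, ‖z k * tensorDiag E.koethe k s‖ ≤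
      (diagBanach hE hA).koethe.norm z * A.tensorNorm (fun _ => E.koethe.Space) s := by
  have hz0 := (diagBanach hE hA).koethe.nonneg_norm hz
  have key : ∀ (M : Fin n → Submodule ℂ E.koethe.Space) (_ : ∀ i, FiniteDimensional ℂ (M i))
      (t : ⨂[ℂ] i, M i) (S : ContinuousMultilinearMap ℂ (fun i => StrongDual ℂ (M i)) ℂ),
      PiTensorProduct.map (fun i => (M i).subtype) t = s → (∀ γ, S γ = tensorEval t γ) →
      ∑ k ∈ Finset.range N, ‖z k * tensorDiag E.koethe k s‖ ≤
        (diagBanach hE hA).koethe.norm z * A.norm (fun i => StrongDual ℂ (M i)) S := by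
    intro M _ t S ht hS
    rw [← ht]
    exact sum_norm_mul_tensorDiag_map_le hE hA hz (fun i => (M i).norm_subtypeL_le) t
      (hA.norm_nonneg_of_strongDual S).1 hS N
  -- Passing to the infimum requires division by the norm of z, so norm zero is treated separately.
  rcases hz0.eq_or_lt with h0 | h0
  · obtain ⟨M, hM, t, ht⟩ := exists_finiteDimensional_map_eq s
    obtain ⟨S, hS⟩ := exists_form_eq_tensorEval t
    have := key M hM t S ht hS
    rw [← h0, zero_mul] at this ⊢
    exact this
  · rw [← div_le_iff₀' h0]
    refine le_tensorNorm fun M hM t S ht hS => ?_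
    rw [div_le_iff₀' h0]
    exact key M hM t S ht hS

/-- A sequence in the Köthe dual of the diagonal space induces a diagonal form which is bounded
for the tensor norm. -/
lemma exists_isDiagonalForm_koethe (hE : E.IsSymmetric) (hA : IsBanachIdeal A) {z : ℕ → ℂ}
    (hz : z ∈ (diagBanach hE hA).koethe.carrier) :
    ∃ T : ContinuousMultilinearMap ℂ (fun _ : Fin n => E.koethe.Space) ℂ,
      IsDiagonalForm E.koethe z T ∧ ∀ s, ‖PiTensorProduct.lift T.toMultilinearMap s‖ ≤
        (diagBanach hE hA).koethe.norm z * A.tensorNorm (fun _ => E.koethe.Space) s := by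
  have hz0 := (diagBanach hE hA).koethe.nonneg_norm hz
  obtain ⟨T, hT⟩ := exists_isDiagonalForm (n := n) (E := E.koethe) (α := z)
    (C := (diagBanach hE hA).koethe.norm z) fun x N => by
      -- Continuity of T_z comes from applying the diagonal estimate to the rank-one form on E given
      -- by the truncated pairings with the x_i.
      let γ : Fin n → StrongDual ℂ E.Space := fun i => (E.pairing N).flip (x i)
      have hγ : ∀ i, ‖γ i‖ ≤ ‖x i‖ := fun i =>
        ContinuousLinearMap.opNorm_le_bound _ (by positivity) fun y => by
          rw [mul_comm]
          exact E.norm_pairing_apply_le N y (x i)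
      have h := sum_norm_mul_diagonal_le hE hA hz (hA.rankOne_mem _ γ) N
      rw [hA.norm_rankOne] at h
      refine le_trans (le_of_eq (Finset.sum_congr rfl fun k hk => ?_)) (h.trans
        (mul_le_mul_of_nonneg_left (Finset.prod_le_prod (fun _ _ => _root_.norm_nonneg _)
          fun i _ => hγ i) hz0))
      rw [rankOneForm_apply]
      simp only [γ, ContinuousLinearMap.flip_apply, E.pairing_unit (Finset.mem_range.1 hk),
        BanachSeqSpace.coordCLM_apply]
  refine ⟨T, hT, fun s => ?_⟩
  refine le_of_tendsto (hasSum_tensorDiag hT s).tendsto_sum_nat.norm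
    (Filter.Eventually.of_forall fun N => ?_)
  exact (_root_.norm_sum_le _ _).trans (sum_norm_mul_tensorDiag_le hE hA hz s N)

/-- The contraction γ ↦ ∑ γ(e_k) e_k into E pulls T back to the form represented by the diagonal
tensor. -/
lemma exists_form_eq_tensorEval_sum (hA : IsBanachIdeal A) {U : Type} [NormedAddCommGroup U]
    [NormedSpace ℂ U] {N : ℕ} {e : ℕ → U} (ι : U →ₗᵢ[ℂ] E.koethe.Space)
    (he : ∀ k < N, ι (e k) = E.koethe.unit k) {β : ℕ → ℂ}
    {T : ContinuousMultilinearMap ℂ (fun _ : Fin n => E.Space) ℂ}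
    (hT : T ∈ A.carrier fun _ => E.Space) (hd : IsDiagonalForm E (truncate N β) T) :
    ∃ S : ContinuousMultilinearMap ℂ (fun _ : Fin n => StrongDual ℂ U) ℂ,
      (∀ γ, S γ = tensorEval (∑ k ∈ Finset.range N,
        β k • PiTensorProduct.tprod ℂ fun _ : Fin n => e k) γ) ∧
      A.norm (fun _ => StrongDual ℂ U) S ≤ A.norm (fun _ => E.Space) T := by
  refine ⟨T.compContinuousLinearMap fun _ => dualToSum N e E.unit, fun γ => ?_,
    hA.norm_comp_le_of_le_one (fun _ => norm_dualToSum_unit_le ι he) hT⟩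
  rw [ContinuousMultilinearMap.compContinuousLinearMap_apply, hd.truncate_apply, tensorEval,
    map_sum]
  refine Finset.sum_congr rfl fun k hk => ?_
  have hk' := Finset.mem_range.1 hk
  rw [map_smul, PiTensorProduct.lift.tprod]
  simp [seq_dualToSum_unit, truncate_of_lt hk']

/-- A finitely supported diagonal form over `E` represents a tensor over the Köthe dual. -/
lemma tensorNorm_sum_unit_le (hA : IsBanachIdeal A) {N : ℕ} {β : ℕ → ℂ}
    {T : ContinuousMultilinearMap ℂ (fun _ : Fin n => E.Space) ℂ}
    (hT : T ∈ A.carrier fun _ => E.Space) (hd : IsDiagonalForm E (truncate N β) T) :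
    A.tensorNorm (fun _ => E.koethe.Space) (∑ k ∈ Finset.range N,
      β k • PiTensorProduct.tprod ℂ fun _ : Fin n => E.koethe.unit k) ≤
      A.norm (fun _ => E.Space) T := by
  let V : Submodule ℂ E.koethe.Space := Submodule.span ℂ (E.koethe.unit '' Finset.range N)
  have : FiniteDimensional ℂ V :=
    FiniteDimensional.span_of_finite ℂ ((Finset.finite_toSet _).image _)
  -- The values from N on are never used.
  let e : ℕ → V := fun k => if h : k < N then
    ⟨E.koethe.unit k, Submodule.subset_span ⟨k, by simpa using h, rfl⟩⟩ else 0
  have he : ∀ k < N, V.subtypeₗᵢ (e k) = E.koethe.unit k := fun k hk => by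
    simp [e, hk]
  obtain ⟨S, hS, hSn⟩ := hA.exists_form_eq_tensorEval_sum V.subtypeₗᵢ he hT hd
  refine (hA.tensorNorm_le (fun _ => V) _ S ?_ hS).trans hSn
  rw [map_sum]
  refine Finset.sum_congr rfl fun k hk => ?_
  rw [map_smul, PiTensorProduct.map_tprod]
  have h := he k (Finset.mem_range.1 hk)
  exact congrArg (fun v => β k • PiTensorProduct.tprod ℂ fun _ : Fin n => v) h

/-- A diagonal form which is bounded for the tensor norm has its coefficients in the Köthe dual of
the diagonal space. -/
lemma mem_koethe_of_bounded (hE : E.IsSymmetric) (hA : IsBanachIdeal A) {α : ℕ → ℂ} {C : ℝ}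
    (hC : 0 ≤ C) {T : ContinuousMultilinearMap ℂ (fun _ : Fin n => E.koethe.Space) ℂ}
    (hd : IsDiagonalForm E.koethe α T) (hT : ∀ s, ‖PiTensorProduct.lift T.toMultilinearMap s‖ ≤
      C * A.tensorNorm (fun _ => E.koethe.Space) s) :
    α ∈ (diagBanach hE hA).koethe.carrier ∧ (diagBanach hE hA).koethe.norm α ≤ C := by
  refine BanachSeqSpace.koethe_norm_le_real hC fun β hβ hβ1 N => ?_
  have h : ∀ k, ∃ θ : ℂ, ‖θ‖ ≤ 1 ∧ θ * (α k * β k) = ‖α k * β k‖ := fun k => exists_phase _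
  choose θ hθ hθ2 using h
  -- The phases make the pairing of T with the diagonal tensor equal to ∑ |α_k β_k|; by solidity the
  -- modified β stays in the unit ball.
  obtain ⟨⟨S, hS, hSd⟩, hn⟩ := (diagBanach hE hA).solid (truncate N fun k => θ k * β k) β hβ
    fun k => (norm_truncate_le _ _ _).trans (by
      rw [norm_mul]
      exact mul_le_of_le_one_left (_root_.norm_nonneg _) (hθ k))
  rw [diagBanach_norm_eq hS hSd] at hn
  have h1 := hT (∑ k ∈ Finset.range N,
    (θ k * β k) • PiTensorProduct.tprod ℂ fun _ : Fin n => E.koethe.unit k)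
  have h2 : PiTensorProduct.lift T.toMultilinearMap (∑ k ∈ Finset.range N,
      (θ k * β k) • PiTensorProduct.tprod ℂ fun _ : Fin n => E.koethe.unit k) =
      ((∑ k ∈ Finset.range N, ‖α k * β k‖ : ℝ) : ℂ) := by
    rw [map_sum, Complex.ofReal_sum]
    refine Finset.sum_congr rfl fun k _ => ?_
    rw [map_smul, PiTensorProduct.lift.tprod, ← hθ2, smul_eq_mul]
    have := hd.apply_unit k
    rw [ContinuousMultilinearMap.coe_coe, this]
    ring
  rw [h2, Complex.norm_real] at h1
  exact (le_abs_self _).trans (h1.trans (mul_le_of_le_one_right hC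
    ((hA.tensorNorm_sum_unit_le hS hSd).trans (hn.trans hβ1))))

/-! ### The two duality identities. -/

theorem koethe_diagSpace_isometricEq (hE : E.IsSymmetric) (hA : IsBanachIdeal A) :
    (diagBanach hE hA).toSeqSpace.koethe.IsometricEq (diagSpace A.adjoint E.koethe) := by
  refine ⟨Set.ext fun α => ⟨fun h => ?_, ?_⟩, fun α h => ?_⟩
  · obtain ⟨T, hTd, hT⟩ := exists_isDiagonalForm_koethe hE hA h
    exact ⟨(diagBanach hE hA).koethe.subset_linf α h, T, ⟨_, hT⟩, hTd⟩
  · rintro ⟨-, T, ⟨C, hC⟩, hTd⟩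
    -- Membership in the adjoint does not require C ≥ 0, so it is replaced by `max C 0`.
    refine (mem_koethe_of_bounded hE hA (le_max_right C 0) hTd fun s => (hC s).trans ?_).1
    exact mul_le_mul_of_nonneg_right (le_max_left _ _) (hA.tensorNorm_nonneg s)
  · obtain ⟨T, hTd, hT⟩ := exists_isDiagonalForm_koethe hE hA h
    rw [diagSpace_norm_eq (A := A.adjoint) ⟨_, hT⟩ hTd]
    have h0 := (diagBanach hE hA).koethe.nonneg_norm h
    have hn : A.adjoint.norm (fun _ => E.koethe.Space) T = (diagBanach hE hA).koethe.norm α := by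
      -- The Köthe norm of α is itself an admissible constant for T, and every admissible constant
      -- is at least as large.
      refine le_antisymm (csInf_le ⟨0, fun C hC => hC.1⟩ ⟨h0, hT⟩) (le_csInf ⟨_, h0, hT⟩ ?_)
      rintro C ⟨hC0, hC⟩
      exact (mem_koethe_of_bounded hE hA hC0 hTd hC).2
    rw [hn]
    exact (ENNReal.ofReal_toReal ((diagBanach hE hA).koethe_norm_ne_top h)).symm

/-- Over a maximal ideal the space of diagonal forms is its own second Köthe dual. -/
lemma mem_of_mem_koethe_koethe (hE : E.IsSymmetric) (hA : IsBanachIdeal A) (hmax : A.IsMaximal)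
    {α : ℕ → ℂ} (hα : α ∈ (diagBanach hE hA).koethe.koethe.carrier) :
    α ∈ (diagBanach hE hA).carrier ∧
      (diagBanach hE hA).norm α ≤ (diagBanach hE hA).koethe.koethe.norm α := by
  have hC0 := (diagBanach hE hA).koethe.koethe.nonneg_norm hα
  have hN := BanachSeqSpace.norm_truncate_le_koethe_koethe hα
  set C := (diagBanach hE hA).koethe.koethe.norm α
  have hex : ∀ N, ∃ T ∈ A.carrier fun _ => E.Space, IsDiagonalForm E (truncate N α) T := fun N =>
    mem_diagBanach.1 ((diagBanach hE hA).truncate_mem N α)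
  choose S hS hSd using hex
  have hSn : ∀ N, A.norm (fun _ => E.Space) (S N) ≤ C := fun N => by
    rw [← diagBanach_norm_eq (hE := hE) (hA := hA) (hS N) (hSd N)]
    exact hN N
  -- The truncated forms have ideal norm at most C, which bounds the partial sums uniformly and
  -- makes the full series a continuous form.
  obtain ⟨T, hT⟩ := exists_isDiagonalForm (n := n) (E := E) (α := α) (C := C) fun x N => by
    refine le_trans (le_of_eq (Finset.sum_congr rfl fun k hk => ?_))
      ((hA.sum_norm_diagonal_le (hS N) x N).trans (mul_le_mul_of_nonneg_right (hSn N)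
        (Finset.prod_nonneg fun _ _ => _root_.norm_nonneg _)))
    rw [(hSd N).apply_unit, truncate_of_lt (Finset.mem_range.1 hk)]
  have hlim : ∀ x, Filter.Tendsto (fun N => S N x) Filter.atTop (nhds (T x)) := fun x =>
    (hT x).tendsto_sum_nat.congr fun N => ((hSd N).truncate_apply x).symm
  -- Restricted to finite-dimensional subspaces, the truncated forms converge pointwise and keep the
  -- bound C; this is what maximality needs.
  have hres : ∀ r ∈ A.restrictionNorms (fun _ => E.Space) T, r ≤ C := by
    rintro _ ⟨M, hM, rfl⟩
    have : ∀ i, CompleteSpace (M i) := fun i => FiniteDimensional.complete ℂ (M i)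
    refine hA.norm_le_of_tendsto
      (u := fun N => (S N).compContinuousLinearMap fun i => (M i).subtypeL)
      (fun x => hlim fun i => x i) fun N => ?_
    exact (hA.norm_restrict_le M (hS N)).trans (hSn N)
  obtain ⟨h1, h2⟩ := hmax fun _ => E.Space
  have hmem : T ∈ A.carrier fun _ => E.Space := by
    rw [h1]
    exact ⟨C, hres⟩
  refine ⟨mem_diagBanach.2 ⟨T, hmem, hT⟩, ?_⟩
  rw [diagBanach_norm_eq hmem hT, h2 T hmem]
  exact Real.sSup_le hres hC0

theorem diagSpace_isometricEq_koethe_koethe (hE : E.IsSymmetric) (hA : IsBanachIdeal A)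
    (hmax : A.IsMaximal) :
    (diagBanach hE hA).toSeqSpace.IsometricEq (diagBanach hE hA).koethe.toSeqSpace.koethe := by
  refine ⟨Set.ext fun α => ⟨fun h => (BanachSeqSpace.koethe_koethe_norm_le h).1,
    fun h => (mem_of_mem_koethe_koethe hE hA hmax h).1⟩, fun α h => ?_⟩
  obtain ⟨h1, h2⟩ := BanachSeqSpace.koethe_koethe_norm_le h
  have h3 := h2.antisymm (mem_of_mem_koethe_koethe hE hA hmax h1).2
  change ENNReal.ofReal _ = _
  rw [← h3]
  exact ENNReal.ofReal_toReal ((diagBanach hE hA).koethe.koethe_norm_ne_top h1)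

end IsBanachIdeal

lemma SeqSpace.IsometricEq.trans {X Y Z : SeqSpace} (h : X.IsometricEq Y) (h' : Y.IsometricEq Z) :
    X.IsometricEq Z :=
  ⟨h.1.trans h'.1, fun x hx => (h.2 x hx).trans (h'.2 x (h.1 ▸ hx))⟩

end

theorem proposition5p6 (n : ℕ) (hn : 1 ≤ n) (E : BanachSeqSpace) (hE : E.IsSymmetric)
    (A : FormClass n) (hA : IsBanachIdeal A) :
    (diagSpace A E).koethe.IsometricEq (diagSpace A.adjoint E.koethe) ∧
      (A.IsMaximal →
        (diagSpace A E).IsometricEq (diagSpace A.adjoint E.koethe).koethe) := by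
  have : NeZero n := ⟨by omega⟩
  have h := diagSpace_isometricEq hE hA
  have h1 := hA.koethe_diagSpace_isometricEq hE
  refine ⟨h.koethe_eq ▸ h1, fun hmax => h.trans ?_⟩
  -- By the first identity the target becomes the Köthe bidual of the space of diagonal forms.
  rw [← h1.koethe_eq, ← (diagBanach hE hA).koethe_toSeqSpace.koethe_eq]
  exact hA.diagSpace_isometricEq_koethe_koethe hE hmax
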